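/- Let $n\ge 0$ and let $\triangle\subset\mathbb R^n$ be the reflexive polytope of $X=\mathbb P^n$, i.e. the simplex with vertices $(-1,\dots,-1),(n,-1,\dots,-1),\dots,(-1,\dots,-1,n)$; its dual polytope $\triangle^\vee$ has vertices $u_0=(-1,\dots,-1)$, $u_k=e_k$ ($1\le k\le n$). Let $\mathcal A=\triangle\cap\mathbb Z^n=\{v_0=0,v_1,\dots,v_p\}$ and $L=\{\ell\in\mathbb Z^{p+1}:\sum_i\ell_iv_i=0,\ \sum_i\ell_i=0\}$. The *extended GKZ system* for a holomorphic function $f(a_0,\dots,a_p)$ consists of the equations $$\Big(\prod_{\ell_i>0}\partial_{a_i}^{\ell_i}-\prod_{\ell_i<0}\partial_{a_i}^{-\ell_i}\Big)f=0\ (\ell\in L),\qquad \sum_{i}v_i^j\,a_i\partial_{a_i}f=0\ (1\le j\le n),\qquad \Big(\sum_{i}a_i\partial_{a_i}+1\Big)f=0,$$ together with $$\pounds_v f=\sum_{v'\in\mathcal A,\ v'\notin F_u}(\langle v',u\rangle+1)\,a_{v'}\,\partial_{a_{v'+v}}f=0$$ for every vertex $u$ of $\triangle^\vee$ and every lattice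 point $v$ in the relative interior of the facet $F_u=\{x\in\triangle:\langle x,u\rangle=-1\}$. Let $\mathcal T$ be a regular projective triangulation of $\triangle$: every maximal simplex has $0$ as a vertex and its other vertices form a $\mathbb Z$-basis of $\mathbb Z^n$, and the set $\mathcal K_{\mathcal T}\subset\mathbb R^{p+1}$ of weights $\omega$ whose lower envelope induces $\mathcal T$ is non-empty. Let $M=\{\ell\in L:\langle\ell,\omega\rangle\ge0\ \forall\omega\in\mathcal K_{\mathcal T}\}$ be the set of integral points of the Mori cone, and let $$H=\mathbb C[D_0,\dots,D_p]/\mathcal I=\mathrm H^\bullet(\widetilde{X^\vee_{\mathcal T}},\mathbb C)$$ be the cohomology ring of the smooth projective toric variety of the fan of cones over the simplices of $\mathcal T$, where $\mathcal I$ is generated by $\sum_{i=0}^pD_i$, by $\sum_i v_i^jD_i$ ($1\le j\le n$), and by the products $D_{i_1}\cdots D_{i_k}$ over sets $\{i_1,\dots,i_k\}\subset\{1,\dots,p\}$ such that $v_{i_1},\dots,v_{i_k}$ do not generate a cone of this fan. Put $$B_{\mathbb P^n,\mathcal T}(a)=\frac1{a_0}\Big(\sum_{\ell\in M}O_\ell\,a^\ell\Big)\exp\Big(\sum_{i=0}^p(\log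 a_i)D_i\Big),$$ $$O_\ell=\frac{\prod_{i\ge1,\,\ell_i<0}D_i(D_i-1)\cdots(D_i+\ell_i+1)}{\prod_{i\ge1,\,\ell_i\ge0}(D_i+1)\cdots(D_i+\ell_i)}\,(D_0-1)(D_0-2)\cdots(D_0+\ell_0).$$ (1) Let $l^{(1)},\dots,l^{(r)}$ be any $\mathbb Z$-basis of $L$ such that every $\ell\in M$ is a combination of the $l^{(j)}$ with non-negative coefficients, and let $x_j=a^{l^{(j)}}$. Then there is $\varepsilon>0$ such that on $\{a\in(\mathbb C^*)^{p+1}:|x_j(a)|<\varepsilon\ \forall j\}$ the series $\sum_{\ell\in M}O_\ell a^\ell$ converges, and for every open subset $U$ of this set, every choice of holomorphic branches on $U$ of $\log a_0,\dots,\log a_p$, and every linear functional $\alpha$ on $H$, the coefficient function $a\mapsto\alpha\big(B_{\mathbb P^n,\mathcal T}(a)\cdot(-D_0)\big)$ is holomorphic on $U$ and solves the extended GKZ system there. (2) The operators $\pounds_v$ are the root vectors of $sl(n+1,\mathbb C)$: with $e_0=0$, the pairs $(u,v)$ above are exactly the pairs $(u_j,e_i-e_j)$ with $0\le i\ne j\le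 n$, and, if $a\in\mathbb C^{\mathcal A}$ is identified with the section $\sum_{v\in\mathcal A}a_v\prod_{k=0}^nz_k^{\langle v,u_k\rangle+1}$ of $-\omega_{\mathbb P^n}$, then $\pounds_{e_i-e_j}$ is the derivative along the linear vector field on $\mathbb C^{\mathcal A}$ given by the action $z_i\,\partial/\partial z_j$ of the elementary matrix $E_{ij}\in sl(n+1,\mathbb C)$ on sections. -/

import Mathlib

noncomputable section

namespace GKZ

/-! ### Reflexive polytopes and their lattice points -/

/-- The inclusion `ℤⁿ → ℝⁿ`. -/
def toReal {n : ℕ} (v : Fin n → ℤ) : Fin n → ℝ := fun k => (v k : ℝ)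

/-- The polar dual `{u | ⟨v, u⟩ ≥ -1 for all v ∈ S}`. -/
def polarDual {n : ℕ} (S : Set (Fin n → ℝ)) : Set (Fin n → ℝ) :=
  {u | ∀ v ∈ S, -1 ≤ v ⬝ᵥ u}

/-- A reflexive polytope in `ℝⁿ`: a lattice polytope with the origin in its interior, whose polar
dual has lattice points as vertices. -/
structure ReflexivePolytope (n : ℕ) where
  /-- a finite set of lattice points whose convex hull is the polytope -/
  verts : Finset (Fin n → ℤ)
  zero_mem_interior : (0 : Fin n → ℝ) ∈
    interior (convexHull ℝ (toReal '' (verts : Set (Fin n → ℤ))))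
  dual_lattice :
    ∀ u ∈ (polarDual (convexHull ℝ (toReal '' (verts : Set (Fin n → ℤ))))).extremePoints ℝ,
      ∃ w : Fin n → ℤ, toReal w = u

/-- The polytope `△` as a subset of `ℝⁿ`. -/
def ReflexivePolytope.carrier {n : ℕ} (P : ReflexivePolytope n) : Set (Fin n → ℝ) :=
  convexHull ℝ (toReal '' (P.verts : Set (Fin n → ℤ)))

/-- The set `𝒜 = △ ∩ ℤⁿ` of lattice points of `△`, as a type. It indexes the variables `a_v`. -/
abbrev ReflexivePolytope.Pt {n : ℕ} (P : ReflexivePolytope n) : Type :=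
  {v : Fin n → ℤ // toReal v ∈ P.carrier}

theorem ReflexivePolytope.finite_points {n : ℕ} (P : ReflexivePolytope n) :
    {v : Fin n → ℤ | toReal v ∈ P.carrier}.Finite := by
  have hb : Bornology.IsBounded P.carrier :=
    isBounded_convexHull.2 ((P.verts.finite_toSet.image toReal).isBounded)
  obtain ⟨R, hR⟩ := hb.exists_norm_le
  refine (Set.finite_Icc (fun _ : Fin n => -⌈R⌉) (fun _ => ⌈R⌉)).subset fun v hv => ?_
  have h : ∀ k, |(v k : ℝ)| ≤ ⌈R⌉ := fun k =>
    ((norm_le_pi_norm (toReal v) k).trans (hR _ hv)).trans (Int.le_ceil R)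
  refine ⟨fun k => ?_, fun k => ?_⟩
  · have := (abs_le.1 (h k)).1
    exact_mod_cast this
  · have := (abs_le.1 (h k)).2
    exact_mod_cast this

instance ReflexivePolytope.fintypePt {n : ℕ} (P : ReflexivePolytope n) : Fintype P.Pt :=
  P.finite_points.fintype

/-- The lattice point `v₀ = 0`. -/
def ReflexivePolytope.origin {n : ℕ} (P : ReflexivePolytope n) : P.Pt :=
  ⟨0, by
    have h : toReal (0 : Fin n → ℤ) = 0 := by ext; simp [toReal]
    rw [h]
    exact interior_subset P.zero_mem_interior⟩

/-! ### The extended GKZ system -/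

/-- The lattice `L` of affine linear relations among the lattice points of `△`. -/
def relationLattice {n : ℕ} (P : ReflexivePolytope n) : Submodule ℤ (P.Pt → ℤ) where
  carrier := {ℓ | (∀ j : Fin n, ∑ v, ℓ v * v.1 j = 0) ∧ ∑ v, ℓ v = 0}
  zero_mem' := by simp
  add_mem' := by
    rintro x y ⟨hx, hx'⟩ ⟨hy, hy'⟩
    exact ⟨fun j => by simp [add_mul, Finset.sum_add_distrib, hx, hy],
      by simp [Finset.sum_add_distrib, hx', hy']⟩
  smul_mem' := by
    rintro c x ⟨hx, hx'⟩
    exact ⟨fun j => by simp [mul_assoc, ← Finset.mul_sum, hx],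
      by simp [← Finset.mul_sum, hx']⟩

/-- The partial derivative `∂f/∂a_v`. -/
def partialDeriv {n : ℕ} {P : ReflexivePolytope n} (v : P.Pt) (f : (P.Pt → ℂ) → ℂ) :
    (P.Pt → ℂ) → ℂ :=
  fun a => fderiv ℂ f a (Pi.single v 1)

/-- The iterated partial derivative `∏_v (∂/∂a_v)^{k_v} f`. -/
def mixedDeriv {n : ℕ} {P : ReflexivePolytope n} (k : P.Pt → ℕ) (f : (P.Pt → ℂ) → ℂ) :
    (P.Pt → ℂ) → ℂ :=
  (Finset.univ : Finset P.Pt).toList.foldr (fun v g => (partialDeriv v)^[k v] g) f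

/-- Holomorphic solutions on `U` of the GKZ system of `△`. -/
structure IsGKZSolution {n : ℕ} (P : ReflexivePolytope n) (U : Set (P.Pt → ℂ))
    (f : (P.Pt → ℂ) → ℂ) : Prop where
  holomorphic : DifferentiableOn ℂ f U
  box : ∀ ℓ ∈ relationLattice P, ∀ a ∈ U,
    mixedDeriv (fun v => (ℓ v).toNat) f a - mixedDeriv (fun v => (-ℓ v).toNat) f a = 0
  torus : ∀ j : Fin n, ∀ a ∈ U, ∑ v : P.Pt, (v.1 j : ℂ) * a v * partialDeriv v f a = 0
  euler : ∀ a ∈ U, ∑ v : P.Pt, a v * partialDeriv v f a + f a = 0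

/-- `u` is a vertex of the dual polytope of `△`, and `v` is a lattice point in the relative
interior of the corresponding facet `F_u = {x ∈ △ | ⟨x, u⟩ = -1}` of `△`. -/
def IsRoot {n : ℕ} (P : ReflexivePolytope n) (u v : Fin n → ℤ) : Prop :=
  toReal u ∈ (polarDual P.carrier).extremePoints ℝ ∧
    toReal v ∈ intrinsicInterior ℝ {x | x ∈ P.carrier ∧ x ⬝ᵥ toReal u = -1}

/-- The operator `£_v = ∑_{v' ∉ F_u} (⟨v', u⟩ + 1) a_{v'} ∂/∂a_{v' + v}`, for `v` in the relative
interior of the facet `F_u`. -/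
def rootOperator {n : ℕ} (P : ReflexivePolytope n) (u v : Fin n → ℤ) (f : (P.Pt → ℂ) → ℂ)
    (a : P.Pt → ℂ) : ℂ :=
  ∑ v' : P.Pt, ∑ w : P.Pt with v'.1 ⬝ᵥ u ≠ -1 ∧ w.1 = v'.1 + v,
    ((v'.1 ⬝ᵥ u + 1 : ℤ) : ℂ) * a v' * partialDeriv w f a

/-- Holomorphic solutions on `U` of the extended GKZ system of `△`. -/
structure IsExtendedGKZSolution {n : ℕ} (P : ReflexivePolytope n) (U : Set (P.Pt → ℂ))
    (f : (P.Pt → ℂ) → ℂ) : Prop extends IsGKZSolution P U f where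
  root : ∀ u v, IsRoot P u v → ∀ a ∈ U, rootOperator P u v f a = 0

/-! ### Regular projective triangulations, Kähler cone and Mori cone -/

/-- The weights `ω ∈ ℝ^𝒜` for which the lower envelope of the points `(v, ω_v)` induces the
triangulation `T`: on each maximal simplex the weights are interpolated by an affine function which
lies strictly below the weights at all other lattice points. This is the preimage in `ℝ^𝒜` of the
(open) Kähler cone in `ℝ^𝒜 / ℝ^{n+1} = H²(X̃ᵛ, ℝ)`. -/
def kaehlerCone {n : ℕ} (P : ReflexivePolytope n) (T : Geometry.SimplicialComplex ℝ (Fin n → ℝ)) :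
    Set (P.Pt → ℝ) :=
  {ω | ∀ s ∈ T.facets, ∃ (c : ℝ) (m : Fin n → ℝ), ∀ v : P.Pt,
    c + m ⬝ᵥ toReal v.1 ≤ ω v ∧ (c + m ⬝ᵥ toReal v.1 = ω v ↔ toReal v.1 ∈ s)}

/-- `T` is a regular projective triangulation of `△`: it triangulates `△`; each of its maximal
simplices has the origin as a vertex, and its other vertices form a `ℤ`-basis of `ℤⁿ` (so that it
has normalized volume one); and `T` is induced by a weight. -/
structure IsRegularProjective {n : ℕ} (P : ReflexivePolytope n)
    (T : Geometry.SimplicialComplex ℝ (Fin n → ℝ)) : Prop where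
  space_eq : T.space = P.carrier
  regular : ∀ s ∈ T.facets, ∃ b : Module.Basis (Fin n) ℤ (Fin n → ℤ),
    (s : Set (Fin n → ℝ)) = insert 0 (Set.range fun k => toReal (b k))
  projective : (kaehlerCone P T).Nonempty

/-- The set `M` of integral points of the Mori cone, the dual cone of the Kähler cone. -/
def moriPoints {n : ℕ} (P : ReflexivePolytope n) (T : Geometry.SimplicialComplex ℝ (Fin n → ℝ)) :
    Set (P.Pt → ℤ) :=
  {ℓ | ℓ ∈ relationLattice P ∧ ∀ ω ∈ kaehlerCone P T, 0 ≤ ∑ v, (ℓ v : ℝ) * ω v}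

/-! ### The cohomology ring -/

open Classical in
/-- The ideal generated by `∑_v D_v`, by `∑_v v_j D_v` for `1 ≤ j ≤ n`, and by the products
`D_{v_1} ⋯ D_{v_k}` over nonzero lattice points `v_1, …, v_k` of `△` which do not span a cone over a
simplex of `T`. -/
def cohomologyIdeal {n : ℕ} (P : ReflexivePolytope n)
    (T : Geometry.SimplicialComplex ℝ (Fin n → ℝ)) : Ideal (MvPolynomial P.Pt ℂ) :=
  Ideal.span
    ({∑ v : P.Pt, MvPolynomial.X v} ∪
      Set.range (fun j : Fin n => ∑ v : P.Pt, MvPolynomial.C (v.1 j : ℂ) * MvPolynomial.X v) ∪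
      {q | ∃ S : Finset P.Pt, S.Nonempty ∧ P.origin ∉ S ∧
        S.image (fun v => toReal v.1) ∉ T.faces ∧ q = ∏ v ∈ S, MvPolynomial.X v})

/-- The cohomology ring `H^•(X̃ᵛ_T, ℂ)` of the smooth projective toric variety whose fan consists of
the cones over the simplices of `T`. -/
def Cohomology {n : ℕ} (P : ReflexivePolytope n)
    (T : Geometry.SimplicialComplex ℝ (Fin n → ℝ)) : Type :=
  MvPolynomial P.Pt ℂ ⧸ cohomologyIdeal P T

instance {n : ℕ} (P : ReflexivePolytope n) (T : Geometry.SimplicialComplex ℝ (Fin n → ℝ)) :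
    CommRing (Cohomology P T) :=
  inferInstanceAs (CommRing (MvPolynomial P.Pt ℂ ⧸ cohomologyIdeal P T))

instance {n : ℕ} (P : ReflexivePolytope n) (T : Geometry.SimplicialComplex ℝ (Fin n → ℝ)) :
    Algebra ℂ (Cohomology P T) :=
  inferInstanceAs (Algebra ℂ (MvPolynomial P.Pt ℂ ⧸ cohomologyIdeal P T))

instance {n : ℕ} (P : ReflexivePolytope n) (T : Geometry.SimplicialComplex ℝ (Fin n → ℝ)) :
    Algebra ℚ (Cohomology P T) :=
  inferInstanceAs (Algebra ℚ (MvPolynomial P.Pt ℂ ⧸ cohomologyIdeal P T))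

/-- The canonical topology of the (finite-dimensional) complex vector space `H^•(X̃ᵛ_T, ℂ)`. -/
instance {n : ℕ} (P : ReflexivePolytope n) (T : Geometry.SimplicialComplex ℝ (Fin n → ℝ)) :
    TopologicalSpace (Cohomology P T) :=
  moduleTopology ℂ (Cohomology P T)

/-- The divisor class `D_v`. For `v = 0` it is the artificial, i.e. canonical, class `D₀`. -/
def divisorClass {n : ℕ} (P : ReflexivePolytope n)
    (T : Geometry.SimplicialComplex ℝ (Fin n → ℝ)) (v : P.Pt) : Cohomology P T :=
  Ideal.Quotient.mk (cohomologyIdeal P T) (MvPolynomial.X v)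

/-! ### The function `B` -/

/-- The class `O_ℓ`, for `ℓ₀ ≤ 0`. All classes `D_v` are nilpotent, so that the denominator is
invertible. -/
def oCoeff {n : ℕ} (P : ReflexivePolytope n) (T : Geometry.SimplicialComplex ℝ (Fin n → ℝ))
    (ℓ : P.Pt → ℤ) : Cohomology P T :=
  (∏ v : P.Pt with v ≠ P.origin ∧ ℓ v < 0,
      ∏ k ∈ Finset.range (-ℓ v).toNat, (divisorClass P T v - (k : Cohomology P T))) *
    Ring.inverse (∏ v : P.Pt with v ≠ P.origin ∧ 0 ≤ ℓ v,
      ∏ k ∈ Finset.range (ℓ v).toNat, (divisorClass P T v + ((k + 1 : ℕ) : Cohomology P T))) *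
    ∏ k ∈ Finset.range (-ℓ P.origin).toNat,
      (divisorClass P T P.origin - ((k + 1 : ℕ) : Cohomology P T))

/-- The Laurent monomial `a^ℓ`. -/
def laurent {n : ℕ} {P : ReflexivePolytope n} (ℓ : P.Pt → ℤ) (a : P.Pt → ℂ) : ℂ :=
  ∏ v, a v ^ ℓ v

/-- The function `B(a) = a₀⁻¹ (∑_{ℓ ∈ M} O_ℓ a^ℓ) exp (∑_v (log a_v) D_v)` with values in
`H^•(X̃ᵛ_T, ℂ)`, where `log a_v` stands for the given branch `lg a v` of the logarithm. -/
def bFunction {n : ℕ} (P : ReflexivePolytope n) (T : Geometry.SimplicialComplex ℝ (Fin n → ℝ))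
    (lg : (P.Pt → ℂ) → P.Pt → ℂ) (a : P.Pt → ℂ) : Cohomology P T :=
  (a P.origin)⁻¹ • ((∑' ℓ : moriPoints P T, laurent ℓ.1 a • oCoeff P T ℓ.1) *
    IsNilpotent.exp (∑ v, lg a v • divisorClass P T v))

/-- The points `a` with all coordinates nonzero and `|x_j(a)| < ε` for the monomials
`x_j = a^{l^{(j)}}`, where `l^{(1)}, …, l^{(r)}` is a given basis of the relation lattice. -/
def lcslNhd {n r : ℕ} (P : ReflexivePolytope n) (l : Module.Basis (Fin r) ℤ (relationLattice P))
    (ε : ℝ) : Set (P.Pt → ℂ) :=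
  {a | (∀ v, a v ≠ 0) ∧ ∀ j, ‖laurent (l j).1 a‖ < ε}

/-- `lg` is a holomorphic choice on `U` of logarithms of all the coordinates. -/
structure IsLogBranch {n : ℕ} {P : ReflexivePolytope n} (U : Set (P.Pt → ℂ))
    (lg : (P.Pt → ℂ) → P.Pt → ℂ) : Prop where
  holomorphic : DifferentiableOn ℂ lg U
  exp_eq : ∀ a ∈ U, ∀ v, Complex.exp (lg a v) = a v

/-! ### Projective space -/

/-- The points `u_0 = (-1, …, -1)` and `u_k = e_k`, `1 ≤ k ≤ n`, of `ℤⁿ`. -/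
def simplexNormal {n : ℕ} : Fin (n + 1) → Fin n → ℤ :=
  Fin.cons (fun _ => -1) (fun k => Pi.single k 1)

/-- The points `0, e_1, …, e_n` of `ℤⁿ`. -/
def simplexPoint {n : ℕ} : Fin (n + 1) → Fin n → ℤ :=
  Fin.cons 0 (fun k => Pi.single k 1)

/-- The points `(-1, …, -1)`, `(n, -1, …, -1)`, …, `(-1, …, -1, n)` of `ℤⁿ`. -/
def simplexVertex {n : ℕ} (i : Fin (n + 1)) : Fin n → ℤ :=
  fun k => (n + 1) * simplexPoint i k - 1

theorem simplexVertex_dot {n : ℕ} (i : Fin (n + 1)) (u : Fin n → ℝ) :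
    toReal (simplexVertex i) ⬝ᵥ u = (n + 1) * (toReal (simplexPoint i) ⬝ᵥ u) - ∑ k, u k := by
  simp only [dotProduct, toReal, simplexVertex, Finset.mul_sum, ← Finset.sum_sub_distrib]
  refine Finset.sum_congr rfl fun k _ => ?_
  push_cast
  ring

theorem mem_simplex {n : ℕ} (x : Fin n → ℝ) (hx : ∀ k, -1 ≤ x k) (hs : ∑ k, x k ≤ 1) :
    x ∈ convexHull ℝ (toReal ''
      ((Finset.univ.image simplexVertex : Finset (Fin n → ℤ)) : Set (Fin n → ℤ))) := by
  have hn : (0 : ℝ) < n + 1 := by positivity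
  refine mem_convexHull_of_exists_fintype
    (Fin.cons ((1 - ∑ k, x k) / (n + 1)) (fun k => (x k + 1) / (n + 1)) : Fin (n + 1) → ℝ)
    (fun i => toReal (simplexVertex i)) ?_ ?_ ?_ ?_
  · intro i
    refine Fin.cases ?_ (fun k => ?_) i
    · exact div_nonneg (by linarith) hn.le
    · exact div_nonneg (by linarith [hx k]) hn.le
  · rw [Fin.sum_univ_succ]
    simp only [Fin.cons_zero, Fin.cons_succ, ← Finset.sum_div, Finset.sum_add_distrib]
    simp only [Finset.sum_const, Finset.card_univ, Fintype.card_fin, nsmul_eq_mul, mul_one]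
    field_simp
    ring
  · intro i
    exact ⟨_, by simp, rfl⟩
  · ext j
    rw [Fin.sum_univ_succ]
    simp only [Fin.cons_zero, Fin.cons_succ, Pi.add_apply, Pi.smul_apply, Finset.sum_apply,
      smul_eq_mul, toReal, simplexVertex, simplexPoint, Pi.zero_apply, Pi.single_apply]
    push_cast
    simp only [mul_sub, mul_ite, mul_one, mul_zero, Finset.sum_sub_distrib, Finset.sum_ite_eq,
      Finset.mem_univ, if_true, ← Finset.sum_div, Finset.sum_add_distrib, Finset.sum_const,
      Finset.card_univ, Fintype.card_fin, nsmul_eq_mul]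
    field_simp
    ring

theorem mem_dualSimplex {n : ℕ} (u : Fin n → ℝ)
    (hu : ∀ i : Fin (n + 1), -1 ≤ toReal (simplexVertex i) ⬝ᵥ u) :
    u ∈ convexHull ℝ (Set.range fun i : Fin (n + 1) => toReal (simplexNormal i : Fin n → ℤ)) := by
  have hn : (0 : ℝ) < n + 1 := by positivity
  have h0 : ∑ k, u k ≤ 1 := by
    have := hu 0
    rw [simplexVertex_dot] at this
    simp [simplexPoint, toReal, dotProduct] at this
    linarith
  have hk : ∀ k, 0 ≤ u k + (1 - ∑ k, u k) / (n + 1) := fun k => by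
    have := hu k.succ
    rw [simplexVertex_dot] at this
    simp [simplexPoint, toReal, dotProduct, Pi.single_apply] at this
    have h2 : u k + (1 - ∑ k, u k) / (n + 1) = ((n + 1) * u k + (1 - ∑ k, u k)) / (n + 1) := by
      field_simp
    rw [h2]
    exact div_nonneg (by linarith) hn.le
  refine mem_convexHull_of_exists_fintype
    (Fin.cons ((1 - ∑ k, u k) / (n + 1)) (fun k => u k + (1 - ∑ k, u k) / (n + 1)) :
      Fin (n + 1) → ℝ)
    (fun i => toReal (simplexNormal i)) ?_ ?_ ?_ ?_
  · intro i
    refine Fin.cases ?_ (fun k => ?_) i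
    · exact div_nonneg (by linarith) hn.le
    · exact hk k
  · rw [Fin.sum_univ_succ]
    simp only [Fin.cons_zero, Fin.cons_succ, Finset.sum_add_distrib]
    simp only [Finset.sum_const, Finset.card_univ, Fintype.card_fin, nsmul_eq_mul]
    field_simp
    ring
  · exact fun i => ⟨i, rfl⟩
  · ext j
    rw [Fin.sum_univ_succ]
    simp only [Fin.cons_zero, Fin.cons_succ, Pi.add_apply, Pi.smul_apply, Finset.sum_apply,
      smul_eq_mul, toReal, simplexNormal, Pi.single_apply]
    push_cast
    simp only [mul_ite, mul_one, mul_zero, Finset.sum_ite_eq, Finset.mem_univ, if_true]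
    ring

theorem neg_one_le_simplexVertex_dot {n : ℕ} (j i : Fin (n + 1)) :
    -1 ≤ toReal (simplexVertex j : Fin n → ℤ) ⬝ᵥ toReal (simplexNormal i) := by
  have hn : (0 : ℝ) ≤ n := by positivity
  rw [simplexVertex_dot]
  refine Fin.cases ?_ (fun k => ?_) i <;> refine Fin.cases ?_ (fun l => ?_) j <;>
    simp [simplexPoint, simplexNormal, toReal, dotProduct, Pi.single_apply]
  · linarith
  · split_ifs <;> linarith

/-- The reflexive polytope of the anticanonically polarized projective space `ℙⁿ`. Its dual
polytope has the vertices `simplexNormal i`, so that its normal fan is the fan of `ℙⁿ`. -/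
def projectivePolytope (n : ℕ) : ReflexivePolytope n where
  verts := Finset.univ.image simplexVertex
  zero_mem_interior := by
    refine mem_interior.2 ⟨{x | (∀ k, -1 < x k) ∧ ∑ k, x k < 1}, ?_, ?_, by simp⟩
    · exact fun x hx => mem_simplex x (fun k => (hx.1 k).le) hx.2.le
    · simp only [Set.ofPred_and, Set.ofPred_forall]
      exact (isOpen_iInter_of_finite fun k => isOpen_lt continuous_const (continuous_apply k)).inter
        (isOpen_lt (by fun_prop) continuous_const)
  dual_lattice := by
    intro u hu
    have hsub : polarDual (convexHull ℝ (toReal ''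
        ((Finset.univ.image simplexVertex : Finset (Fin n → ℤ)) : Set (Fin n → ℤ)))) =
        convexHull ℝ (Set.range fun i : Fin (n + 1) => toReal (simplexNormal i : Fin n → ℤ)) := by
      refine Set.Subset.antisymm (fun w hw => mem_dualSimplex w fun i =>
        hw _ (subset_convexHull ℝ _ ⟨_, by simp, rfl⟩)) ?_
      refine convexHull_min ?_ ?_
      · rintro _ ⟨i, rfl⟩ v hv
        refine convexHull_min (t := {x | -1 ≤ x ⬝ᵥ toReal (simplexNormal i)}) ?_ ?_ hv
        · rintro _ ⟨w, hw, rfl⟩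
          obtain ⟨j, -, rfl⟩ := Finset.mem_image.1 (Finset.mem_coe.1 hw)
          exact neg_one_le_simplexVertex_dot j i
        · exact convex_halfSpace_ge ⟨fun x y => add_dotProduct x y _,
            fun c x => smul_dotProduct c x _⟩ _
      · intro x hx y hy s t hs ht hst v hv
        have h1 := hx v hv
        have h2 := hy v hv
        rw [dotProduct_add, dotProduct_smul, dotProduct_smul, smul_eq_mul, smul_eq_mul]
        nlinarith
    rw [hsub] at hu
    obtain ⟨i, hi⟩ := extremePoints_convexHull_subset hu
    exact ⟨_, hi⟩

/-- The section `∑_v a_v ∏_i z_i^{⟨v, u_i⟩ + 1}` of the anticanonical bundle of `ℙⁿ` with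
coefficients `a`, as a homogeneous polynomial of degree `n + 1` in `z_0, …, z_n`. -/
def anticanonicalSection {n : ℕ} (a : (projectivePolytope n).Pt → ℂ) :
    MvPolynomial (Fin (n + 1)) ℂ :=
  ∑ v : (projectivePolytope n).Pt,
    MvPolynomial.C (a v) * ∏ i, MvPolynomial.X i ^ (v.1 ⬝ᵥ simplexNormal i + 1).toNat

/-- The infinitesimal action of `A ∈ sl(n+1, ℂ)` on `ℂ[z_0, …, z_n]` by linear vector fields, where
the elementary matrix `E_{ij}` acts by `z_i ∂/∂z_j`. -/
def slAction {n : ℕ} (A : LieAlgebra.SpecialLinear.sl (Fin (n + 1)) ℂ)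
    (q : MvPolynomial (Fin (n + 1)) ℂ) : MvPolynomial (Fin (n + 1)) ℂ :=
  ∑ i, ∑ j, A.1 i j • (MvPolynomial.X i * MvPolynomial.pderiv j q)

end GKZ

end

/-!
Put `c_m(D) = ∏_v Γ(D_v + 1) / Γ(D_v + m_v + 1)` and
`Φ_γ(a) = exp (∑_v log a_v D_v) ∑_{ℓ ∈ L} c_{γ + ℓ}(D) a^{γ + ℓ}`. The functional equation of `Γ`
gives `∂_v Φ_γ = Φ_{γ - e_v}` and `a_v ∂_v Φ_γ = ∑ (D_v + γ_v + ℓ_v) (ℓ-th term of Φ_γ)`. The box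
equations for `Φ_γ` hold because `Φ_γ` depends only on the class of `γ` modulo `L`, and every first
order equation reduces to a linear relation among the `D_v`. For a root `(u, v)`, the same lattice
shift turns `a_{v'} ∂_{v' + v}` into `a_w ∂_w` for a fixed `w`, so `£_v` reduces to the relation
`∑ (⟨v', u⟩ + 1) (D_{v'} + m_{v'}) = 0`.

The function `B · D_0` is `Φ_{-e_0}`: `O_ℓ D_0 = c_{ℓ - e_0}(D)` for `ℓ` in the Mori cone, and
`c_{ℓ - e_0}(D) = 0` for all other `ℓ ∈ L`, because `c_m(D)` is divisible by the product of the
`D_v` with `m_v < 0`, while that set of `v` spans no cone of the fan. Since `H` is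
finite-dimensional, it can be normed as a Banach algebra, in which the estimate
`c_m(D) = O(Q^{|m|})` gives convergence.
-/

noncomputable section

namespace GKZ

/-! ### Quotients of Gamma functions -/

section GammaQuotients

variable {R : Type*} [CommRing R]

/-- The quotient `Γ(D + 1) / Γ(D + m + 1)` for an integer `m`, written without Gamma functions so
that `D` may be an element of a ring. It is meaningful if `D + 1, D + 2, …` are units. -/
def gammaQuot (D : R) (m : ℤ) : R :=
  (∏ k ∈ Finset.range (-m).toNat, (D - (k : R))) *
    Ring.inverse (∏ k ∈ Finset.range m.toNat, (D + ((k + 1 : ℕ) : R)))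

theorem gammaQuot_of_nonpos (D : R) {m : ℤ} (hm : m ≤ 0) :
    gammaQuot D m = ∏ k ∈ Finset.range (-m).toNat, (D - (k : R)) := by
  simp [gammaQuot, Int.toNat_of_nonpos hm]

theorem gammaQuot_of_nonneg (D : R) {m : ℤ} (hm : 0 ≤ m) :
    gammaQuot D m = Ring.inverse (∏ k ∈ Finset.range m.toNat, (D + ((k + 1 : ℕ) : R))) := by
  simp [gammaQuot, Int.toNat_of_nonpos (neg_nonpos.2 hm)]

theorem gammaQuot_sub_one {D : R} (hD : ∀ k : ℕ, IsUnit (D + ((k + 1 : ℕ) : R))) (m : ℤ) :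
    gammaQuot D (m - 1) = (D + (m : R)) * gammaQuot D m := by
  rcases le_or_gt m 0 with hm | hm
  · obtain ⟨k, rfl⟩ := Int.exists_eq_neg_ofNat hm
    rw [gammaQuot_of_nonpos D hm, gammaQuot_of_nonpos D (by omega),
      show (-(-(k : ℤ) - 1)).toNat = k + 1 by omega, show (-(-(k : ℤ))).toNat = k by omega,
      Finset.prod_range_succ]
    push_cast
    ring
  · obtain ⟨k, rfl⟩ : ∃ k : ℕ, m = (k + 1 : ℕ) := ⟨m.toNat - 1, by omega⟩
    rw [gammaQuot_of_nonneg D hm.le, gammaQuot_of_nonneg D (by omega),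
      show ((k + 1 : ℕ) - 1 : ℤ).toNat = k by omega, Int.toNat_natCast, Int.cast_natCast,
      Finset.prod_range_succ, Ring.mul_inverse_rev, ← mul_assoc, Ring.mul_inverse_cancel _ (hD k),
      one_mul]

theorem gammaQuot_sub_one_of_nonpos (D : R) {m : ℤ} (hm : m ≤ 0) :
    gammaQuot D (m - 1) = D * gammaQuot (D - 1) m := by
  obtain ⟨k, rfl⟩ := Int.exists_eq_neg_ofNat hm
  rw [gammaQuot_of_nonpos _ hm, gammaQuot_of_nonpos _ (by omega),
    show (-(-(k : ℤ) - 1)).toNat = k + 1 by omega, show (-(-(k : ℤ))).toNat = k by omega,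
    Finset.prod_range_succ', Nat.cast_zero, sub_zero, mul_comm]
  simp only [Nat.cast_add, Nat.cast_one, sub_sub, add_comm]

theorem dvd_gammaQuot_of_neg (D : R) {m : ℤ} (hm : m < 0) : D ∣ gammaQuot D m := by
  have hstep := gammaQuot_sub_one_of_nonpos D (m := m + 1) (by omega)
  rw [add_sub_cancel_right] at hstep
  exact ⟨_, hstep⟩

theorem isUnit_add_natCast_succ_of_isNilpotent [Algebra ℚ R] {D : R} (hD : IsNilpotent D) (k : ℕ) :
    IsUnit (D + ((k + 1 : ℕ) : R)) := by
  have h : IsUnit ((k + 1 : ℕ) : R) := by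
    simpa using (IsUnit.mk0 ((k + 1 : ℕ) : ℚ) (by positivity)).map (algebraMap ℚ R)
  rw [add_comm]
  exact hD.isUnit_add_left_of_commute h (Commute.all _ _)

theorem map_ringInverse_of_isUnit {M₀ M₀' F : Type*} [CommMonoidWithZero M₀]
    [CommMonoidWithZero M₀'] [FunLike F M₀ M₀'] [MonoidHomClass F M₀ M₀'] (φ : F) {x : M₀}
    (hx : IsUnit x) : φ (Ring.inverse x) = Ring.inverse (φ x) := by
  obtain ⟨u, rfl⟩ := hx
  rw [Ring.inverse_unit, show φ u = (Units.map (φ : M₀ →* M₀') u : M₀') from rfl,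
    Ring.inverse_unit, ← map_inv]
  rfl

theorem map_ringInverse {M₀ M₀' : Type*} [CommMonoidWithZero M₀] [CommMonoidWithZero M₀']
    (e : M₀ ≃* M₀') (x : M₀) : e (Ring.inverse x) = Ring.inverse (e x) := by
  by_cases hx : IsUnit x
  · exact map_ringInverse_of_isUnit e hx
  · rw [Ring.inverse_non_unit x hx, Ring.inverse_non_unit _ (by rwa [MulEquiv.isUnit_map]),
      map_zero]

theorem map_gammaQuot {S : Type*} [CommRing S] (e : R ≃+* S) (D : R) (m : ℤ) :
    e (gammaQuot D m) = gammaQuot (e D) m := by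
  have hinv := map_ringInverse (e : R ≃* S) (∏ k ∈ Finset.range m.toNat, (D + ((k + 1 : ℕ) : R)))
  rw [RingEquiv.coe_toMulEquiv] at hinv
  simp only [gammaQuot, map_mul, hinv, map_prod, map_sub, map_add, map_natCast]

variable {ι : Type*} [Fintype ι]

/-- The coefficient `∏_v Γ(D_v + 1) / Γ(D_v + m_v + 1)` of the monomial `a^m` in the hypergeometric
series with exponents `D`. -/
def gammaCoeff (D : ι → R) (m : ι → ℤ) : R :=
  ∏ v, gammaQuot (D v) (m v)

theorem gammaCoeff_sub_single [DecidableEq ι] {D : ι → R}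
    (hD : ∀ v, ∀ k : ℕ, IsUnit (D v + ((k + 1 : ℕ) : R))) (m : ι → ℤ) (v : ι) :
    gammaCoeff D (m - Pi.single v 1) = (D v + (m v : R)) * gammaCoeff D m := by
  simp only [gammaCoeff]
  rw [Fintype.prod_eq_mul_prod_compl v, Fintype.prod_eq_mul_prod_compl v, ← mul_assoc,
    Pi.sub_apply, Pi.single_eq_same, gammaQuot_sub_one (hD v)]
  congr 1
  refine Finset.prod_congr rfl fun w hw => ?_
  rw [Pi.sub_apply, Pi.single_eq_of_ne (by simpa using hw), sub_zero]

theorem gammaCoeff_sub_single_of_nonpos [DecidableEq ι] (D : ι → R) {m : ι → ℤ} {v : ι}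
    (hm : m v ≤ 0) :
    gammaCoeff D (m - Pi.single v 1) = D v * gammaCoeff (Function.update D v (D v - 1)) m := by
  simp only [gammaCoeff]
  rw [Fintype.prod_eq_mul_prod_compl v, Fintype.prod_eq_mul_prod_compl v, ← mul_assoc,
    Pi.sub_apply, Pi.single_eq_same, Function.update_self, gammaQuot_sub_one_of_nonpos _ hm]
  congr 1
  refine Finset.prod_congr rfl fun w hw => ?_
  have hwv : w ≠ v := by simpa using hw
  rw [Pi.sub_apply, Pi.single_eq_of_ne hwv, sub_zero, Function.update_of_ne hwv]

theorem prod_dvd_gammaCoeff (D : ι → R) {m : ι → ℤ} {S : Finset ι} (hS : ∀ v ∈ S, m v < 0) :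
    ∏ v ∈ S, D v ∣ gammaCoeff D m :=
  (Finset.prod_dvd_prod_of_dvd _ _ fun v hv => dvd_gammaQuot_of_neg _ (hS v hv)).trans
    (Finset.prod_dvd_prod_of_subset _ _ _ (Finset.subset_univ S))

theorem map_gammaCoeff {S : Type*} [CommRing S] (e : R ≃+* S) (D : ι → R) (m : ι → ℤ) :
    e (gammaCoeff D m) = gammaCoeff (e ∘ D) m := by
  simp only [gammaCoeff, map_prod, map_gammaQuot, Function.comp_apply]

end GammaQuotients

/-! ### Growth of the coefficients -/

section Growth

/-- The `ℓ¹`-norm of an integer vector, as a natural number. -/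
def oneNorm {ι : Type*} [Fintype ι] (m : ι → ℤ) : ℕ := ∑ v, (m v).natAbs

theorem natAbs_le_oneNorm {ι : Type*} [Fintype ι] (m : ι → ℤ) (v : ι) :
    (m v).natAbs ≤ oneNorm m :=
  Finset.single_le_sum (f := fun v => (m v).natAbs) (fun _ _ => Nat.zero_le _) (Finset.mem_univ v)

theorem oneNorm_add_le {ι : Type*} [Fintype ι] (m k : ι → ℤ) :
    oneNorm (m + k) ≤ oneNorm m + oneNorm k := by
  rw [oneNorm, oneNorm, oneNorm, ← Finset.sum_add_distrib]
  exact Finset.sum_le_sum fun v _ => Int.natAbs_add_le _ _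

theorem factorial_add_le_two_pow_mul (a b : ℕ) :
    (a + b).factorial ≤ 2 ^ (a + b) * (a.factorial * b.factorial) := by
  rw [← Nat.add_choose_mul_factorial_mul_factorial a b, mul_assoc]
  exact Nat.mul_le_mul_right _ (Nat.choose_le_two_pow _ _)

theorem factorial_sum_le_pow_mul_prod {κ : Type*} (s : Finset κ) (k : κ → ℕ) :
    (∑ i ∈ s, k i).factorial ≤ (2 ^ s.card) ^ (∑ i ∈ s, k i) * ∏ i ∈ s, (k i).factorial := by
  classical
  induction s using Finset.induction_on with
  | empty => simp
  | insert i s hi ih =>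
    rw [Finset.sum_insert hi, Finset.prod_insert hi, Finset.card_insert_of_notMem hi]
    calc _ ≤ 2 ^ (k i + ∑ i ∈ s, k i) * ((k i).factorial * (∑ i ∈ s, k i).factorial) :=
          factorial_add_le_two_pow_mul _ _
      _ ≤ 2 ^ (k i + ∑ i ∈ s, k i) * ((k i).factorial *
          ((2 ^ s.card) ^ (k i + ∑ i ∈ s, k i) * ∏ i ∈ s, (k i).factorial)) := by
          gcongr
          refine ih.trans ?_
          gcongr
          · exact Nat.one_le_two_pow
          · omega
      _ = _ := by
          rw [pow_succ, mul_pow]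
          ring

/-- The order of magnitude `1 / m!` (for `m ≥ 0`) or `|m|!` (for `m < 0`) of `gammaQuot D m`, up to
exponential factors. -/
def gammaWeight (m : ℤ) : ℝ :=
  ((-m).toNat.factorial : ℝ) / (m.toNat.factorial : ℝ)

theorem gammaWeight_nonneg (m : ℤ) : 0 ≤ gammaWeight m := by
  unfold gammaWeight; positivity

theorem prod_factorial_neg_le {ι : Type*} [Fintype ι] (m : ι → ℤ) :
    (∏ v, (-m v).toNat.factorial) ≤
      2 ^ (∑ v, m v).natAbs * (∑ v, m v).natAbs.factorial *
        (2 * 2 ^ Fintype.card ι) ^ oneNorm m * ∏ v, (m v).toNat.factorial := by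
  set s := ∑ v, m v with hs
  set p := ∑ v, (m v).toNat with hp
  set q := ∑ v, (-m v).toNat with hq
  have hpq : (p : ℤ) - q = s := by
    push_cast [hp, hq, hs]
    rw [← Finset.sum_sub_distrib]
    exact Finset.sum_congr rfl fun v _ => Int.toNat_sub_toNat_neg _
  have hp_le : p ≤ oneNorm m := Finset.sum_le_sum fun v _ => by omega
  calc ∏ v, (-m v).toNat.factorial ≤ q.factorial :=
        Nat.le_of_dvd (Nat.factorial_pos _) (Nat.prod_factorial_dvd_factorial_sum _ _)
    _ ≤ (p + s.natAbs).factorial := Nat.factorial_le (by omega)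
    _ ≤ 2 ^ (p + s.natAbs) * (p.factorial * s.natAbs.factorial) :=
        factorial_add_le_two_pow_mul _ _
    _ ≤ 2 ^ (p + s.natAbs) * (((2 ^ Fintype.card ι) ^ p * ∏ v, (m v).toNat.factorial) *
        s.natAbs.factorial) := by
        gcongr
        exact factorial_sum_le_pow_mul_prod Finset.univ fun v => (m v).toNat
    _ = 2 ^ s.natAbs * s.natAbs.factorial * (2 * 2 ^ Fintype.card ι) ^ p *
        ∏ v, (m v).toNat.factorial := by rw [mul_pow]; ring
    _ ≤ _ := by
        gcongr
        exact Nat.one_le_iff_ne_zero.2 (by positivity)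

theorem prod_gammaWeight_le {ι : Type*} [Fintype ι] (m : ι → ℤ) :
    ∏ v, gammaWeight (m v) ≤ 2 ^ (∑ v, m v).natAbs * (∑ v, m v).natAbs.factorial *
      (2 * 2 ^ Fintype.card ι) ^ oneNorm m := by
  simp only [gammaWeight]
  rw [Finset.prod_div_distrib, div_le_iff₀ (by positivity)]
  exact_mod_cast prod_factorial_neg_le m

variable {R : Type*} [NormedCommRing R]

theorem norm_prod_le_norm_one_mul {κ : Type*} (s : Finset κ) (f : κ → R) :
    ‖∏ i ∈ s, f i‖ ≤ ‖(1 : R)‖ * ∏ i ∈ s, ‖f i‖ := by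
  classical
  induction s using Finset.induction_on with
  | empty => simp
  | insert i s hi ih =>
    rw [Finset.prod_insert hi, Finset.prod_insert hi, mul_left_comm]
    exact (norm_mul_le _ _).trans (by gcongr)

theorem norm_natCast_le_mul_norm_one (k : ℕ) : ‖(k : R)‖ ≤ k * ‖(1 : R)‖ := by
  rw [← nsmul_one]
  exact norm_nsmul_le

theorem norm_prod_sub_natCast_le (D : R) (n : ℕ) :
    ‖∏ k ∈ Finset.range n, (D - (k : R))‖ ≤
      ‖(1 : R)‖ * ((‖D‖ + ‖(1 : R)‖) ^ n * n.factorial) := by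
  refine (norm_prod_le_norm_one_mul _ _).trans ?_
  gcongr
  rw [← Finset.prod_range_add_one_eq_factorial, Nat.cast_prod, Finset.pow_eq_prod_const,
    ← Finset.prod_mul_distrib]
  refine Finset.prod_le_prod (fun _ _ => norm_nonneg _) fun k _ => ?_
  push_cast
  nlinarith [norm_sub_le D (k : R), norm_natCast_le_mul_norm_one (R := R) k, norm_nonneg D,
    norm_nonneg (1 : R), mul_nonneg (norm_nonneg D) (Nat.cast_nonneg (α := ℝ) k)]

variable [NormedAlgebra ℂ R] [CompleteSpace R]

theorem exists_norm_inverse_add_natCast_succ_le (D : R) :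
    ∃ C : ℝ, 0 ≤ C ∧ ∀ k : ℕ, ‖Ring.inverse (D + ((k + 1 : ℕ) : R))‖ ≤ C / (k + 1) := by
  have hrescale (k : ℕ) : Ring.inverse (D + ((k + 1 : ℕ) : R)) =
      ((k + 1 : ℕ) : ℂ)⁻¹ • Ring.inverse (((k + 1 : ℕ) : ℂ)⁻¹ • D + 1) := by
    have hk : ((k + 1 : ℕ) : ℂ) ≠ 0 := Nat.cast_ne_zero.2 k.succ_ne_zero
    rw [Algebra.smul_def, ← Ring.inverse_eq_inv', map_ringInverse_of_isUnit _ (IsUnit.mk0 _ hk),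
      ← Ring.mul_inverse_rev, Algebra.smul_def, Ring.inverse_eq_inv', add_mul, one_mul,
      mul_right_comm, ← map_mul, inv_mul_cancel₀ hk, map_one, one_mul, map_natCast]
  have htendsto : Filter.Tendsto (fun k : ℕ => Ring.inverse (((k + 1 : ℕ) : ℂ)⁻¹ • D + 1))
      Filter.atTop (nhds (Ring.inverse (((1 : Rˣ) : R)))) := by
    refine (NormedRing.inverse_continuousAt (1 : Rˣ)).tendsto.comp ?_
    have hinv := (tendsto_inv_atTop_nhds_zero_nat (𝕜 := ℂ)).comp (Filter.tendsto_add_atTop_nat 1)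
    simpa using (hinv.smul_const D).add_const 1
  obtain ⟨C, hC⟩ := (Metric.isBounded_range_of_tendsto _ htendsto).exists_norm_le
  refine ⟨C, (norm_nonneg _).trans (hC _ ⟨0, rfl⟩), fun k => ?_⟩
  rw [hrescale, norm_smul, norm_inv, Complex.norm_natCast, ← div_eq_inv_mul]
  push_cast
  gcongr
  exact_mod_cast hC _ ⟨k, rfl⟩

theorem exists_norm_gammaQuot_le (D : R) :
    ∃ Q : ℝ, ∀ m : ℤ, ‖gammaQuot D m‖ ≤ ‖(1 : R)‖ * (Q ^ m.natAbs * gammaWeight m) := by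
  obtain ⟨C, hC0, hC⟩ := exists_norm_inverse_add_natCast_succ_le D
  refine ⟨‖D‖ + ‖(1 : R)‖ + C, fun m => ?_⟩
  rcases le_total m 0 with hm | hm
  · rw [gammaQuot_of_nonpos D hm, gammaWeight, Int.toNat_of_nonpos hm, Nat.factorial_zero,
      Nat.cast_one, div_one, show m.natAbs = (-m).toNat by omega]
    refine (norm_prod_sub_natCast_le D _).trans ?_
    gcongr ‖(1 : R)‖ * (?_ ^ _ * _)
    linarith
  · rw [gammaQuot_of_nonneg D hm, gammaWeight, Int.toNat_of_nonpos (neg_nonpos.2 hm),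
      ← MonoidWithZero.coe_inverse, map_prod, show m.natAbs = m.toNat by omega]
    refine (norm_prod_le_norm_one_mul _ _).trans ?_
    gcongr
    rw [← Finset.prod_range_add_one_eq_factorial m.toNat, Nat.cast_prod, Nat.factorial_zero,
      Nat.cast_one, mul_one_div, Finset.pow_eq_prod_const, ← Finset.prod_div_distrib]
    refine Finset.prod_le_prod (fun _ _ => norm_nonneg _) fun k _ => (hC k).trans ?_
    push_cast
    gcongr
    linarith [norm_nonneg D, norm_nonneg (1 : R)]

theorem exists_norm_gammaCoeff_le {ι : Type*} [Fintype ι] (D : ι → R) :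
    ∃ Q : ℝ, 1 ≤ Q ∧ ∀ s : ℤ, ∃ C : ℝ, ∀ m : ι → ℤ, ∑ v, m v = s →
      ‖gammaCoeff D m‖ ≤ C * Q ^ oneNorm m := by
  choose q hq using fun v => exists_norm_gammaQuot_le (D v)
  obtain ⟨Q, hQ⟩ := Finite.exists_le fun v => |q v|
  set c := (2 * 2 ^ Fintype.card ι : ℝ)
  have hc : 1 ≤ c := by
    linarith [one_le_pow₀ (M₀ := ℝ) one_le_two (n := Fintype.card ι)]
  refine ⟨max 1 Q * c, one_le_mul_of_one_le_of_one_le (le_max_left _ _) hc, fun s =>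
    ⟨‖(1 : R)‖ * ‖(1 : R)‖ ^ Fintype.card ι * (2 ^ s.natAbs * s.natAbs.factorial),
      fun m hm => ?_⟩⟩
  calc ‖gammaCoeff D m‖ ≤ ‖(1 : R)‖ * ∏ v, ‖gammaQuot (D v) (m v)‖ :=
        norm_prod_le_norm_one_mul _ _
    _ ≤ ‖(1 : R)‖ * ∏ v, (‖(1 : R)‖ * (max 1 Q ^ (m v).natAbs * gammaWeight (m v))) := by
        gcongr with v
        have := gammaWeight_nonneg (m v)
        refine (hq v _).trans ?_
        gcongr ‖(1 : R)‖ * (?_ * gammaWeight (m v))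
        refine (le_abs_self _).trans ?_
        rw [abs_pow]
        gcongr
        exact (hQ v).trans (le_max_right _ _)
    _ = ‖(1 : R)‖ * ‖(1 : R)‖ ^ Fintype.card ι * max 1 Q ^ oneNorm m *
          ∏ v, gammaWeight (m v) := by
        rw [Finset.prod_mul_distrib, Finset.prod_mul_distrib, Finset.prod_pow_eq_pow_sum,
          Finset.prod_const, Finset.card_univ, oneNorm]
        ring
    _ ≤ ‖(1 : R)‖ * ‖(1 : R)‖ ^ Fintype.card ι * max 1 Q ^ oneNorm m *
          (2 ^ s.natAbs * s.natAbs.factorial * c ^ oneNorm m) := by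
        gcongr
        exact hm ▸ prod_gammaWeight_le m
    _ = _ := by rw [mul_pow]; ring

end Growth

/-! ### Laurent monomials near the large complex structure limit -/

section LaurentMonomials

variable {n : ℕ} {P : ReflexivePolytope n}

theorem laurent_add {a : P.Pt → ℂ} (ha : ∀ v, a v ≠ 0) (k m : P.Pt → ℤ) :
    laurent (k + m) a = laurent k a * laurent m a := by
  simp only [laurent, Pi.add_apply, ← Finset.prod_mul_distrib]
  exact Finset.prod_congr rfl fun v _ => zpow_add₀ (ha v) _ _

theorem laurent_single (a : P.Pt → ℂ) (v : P.Pt) : laurent (Pi.single v 1) a = a v := by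
  rw [laurent, Fintype.prod_eq_single v fun w hw => by rw [Pi.single_eq_of_ne hw, zpow_zero],
    Pi.single_eq_same, zpow_one]

theorem mul_laurent_sub_single {a : P.Pt → ℂ} (ha : ∀ v, a v ≠ 0) (m : P.Pt → ℤ) (v : P.Pt) :
    a v * laurent (m - Pi.single v 1) a = laurent m a := by
  nth_rewrite 1 [← laurent_single a v]
  rw [← laurent_add ha, add_sub_cancel]

theorem laurent_sum_zsmul {κ : Type*} (s : Finset κ) {a : P.Pt → ℂ} (ha : ∀ v, a v ≠ 0)
    (c : κ → ℤ) (m : κ → P.Pt → ℤ) :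
    laurent (∑ j ∈ s, c j • m j) a = ∏ j ∈ s, laurent (m j) a ^ c j := by
  classical
  induction s using Finset.induction_on with
  | empty => simp [laurent]
  | insert j s hj ih =>
    rw [Finset.sum_insert hj, Finset.prod_insert hj, laurent_add ha, ih]
    simp only [laurent, ← Finset.prod_zpow, Pi.smul_apply, smul_eq_mul, mul_comm (c j), zpow_mul]

theorem isOpen_forall_ne_zero {ι : Type*} [Finite ι] : IsOpen {a : ι → ℂ | ∀ v, a v ≠ 0} := by
  simp only [Set.ofPred_forall]
  exact isOpen_iInter_of_finite fun v => isOpen_ne.preimage (continuous_apply v)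

/-- The continuous linear map on `ℂ^ι` with the given values on the standard basis: the derivative
of a function with these partial derivatives. -/
def ofPartials {ι E : Type*} [Fintype ι] [NormedAddCommGroup E] [NormedSpace ℂ E] (g : ι → E) :
    (ι → ℂ) →L[ℂ] E :=
  ∑ v, (ContinuousLinearMap.proj (R := ℂ) (φ := fun _ : ι => ℂ) v).smulRight (g v)

section OfPartials

variable {ι E : Type*} [Fintype ι] [NormedAddCommGroup E] [NormedSpace ℂ E]

theorem ofPartials_apply (g : ι → E) (x : ι → ℂ) : ofPartials g x = ∑ v, x v • g v := by
  simp [ofPartials, sum_apply]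

theorem ofPartials_single [DecidableEq ι] (g : ι → E) (v : ι) :
    ofPartials g (Pi.single v 1) = g v := by
  simp [ofPartials_apply, Pi.single_apply]

theorem eq_ofPartials [DecidableEq ι] (F : (ι → ℂ) →L[ℂ] E) :
    F = ofPartials fun v => F (Pi.single v 1) := by
  ext x
  conv_lhs => rw [pi_eq_sum_univ' x, map_sum]
  simp only [map_smul, ofPartials_apply]

theorem hasSum_ofPartials {κ : Type*} {g : κ → ι → E} {s : ι → E}
    (hs : ∀ v, HasSum (fun k => g k v) (s v)) :
    HasSum (fun k => ofPartials (g k)) (ofPartials s) :=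
  hasSum_sum fun v _ => (ContinuousLinearMap.smulRightL ℂ (ι → ℂ) E
    (.proj (R := ℂ) (φ := fun _ : ι => ℂ) v)).hasSum (hs v)

theorem norm_ofPartials_le (g : ι → E) : ‖ofPartials g‖ ≤ ∑ v, ‖g v‖ := by
  refine ContinuousLinearMap.opNorm_le_bound _ (by positivity) fun x => ?_
  rw [ofPartials_apply, Finset.sum_mul]
  refine (norm_sum_le _ _).trans (Finset.sum_le_sum fun v _ => ?_)
  rw [norm_smul, mul_comm]
  gcongr
  exact norm_le_pi_norm x v

end OfPartials

theorem hasFDerivAt_laurent {a : P.Pt → ℂ} (ha : ∀ v, a v ≠ 0) (m : P.Pt → ℤ) :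
    HasFDerivAt (laurent m) (ofPartials fun v => (m v : ℂ) * laurent (m - Pi.single v 1) a) a := by
  have hfactor (v : P.Pt) : HasFDerivAt (fun y : P.Pt → ℂ => y v ^ m v)
      (((m v : ℂ) * a v ^ (m v - 1)) •
        ContinuousLinearMap.proj (R := ℂ) (φ := fun _ : P.Pt => ℂ) v) a :=
    HasDerivAt.comp_hasFDerivAt (h₂ := fun z : ℂ => z ^ m v) (f := fun y : P.Pt → ℂ => y v) a
      (hasDerivAt_zpow (m v) (a v) (Or.inl (ha v))) (hasFDerivAt_apply v a)
  have herase (v : P.Pt) : laurent (m - Pi.single v 1) a =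
      a v ^ (m v - 1) * ∏ w ∈ Finset.univ.erase v, a w ^ m w := by
    rw [laurent, ← Finset.mul_prod_erase _ _ (Finset.mem_univ v), Pi.sub_apply, Pi.single_eq_same]
    refine congrArg _ (Finset.prod_congr rfl fun w hw => ?_)
    rw [Pi.sub_apply, Pi.single_eq_of_ne (Finset.ne_of_mem_erase hw), sub_zero]
  refine (HasFDerivAt.finsetProd (u := Finset.univ) fun v _ => hfactor v).congr_fderiv ?_
  ext x
  rw [ofPartials_apply, sum_apply]
  refine Finset.sum_congr rfl fun v _ => ?_
  simp only [herase, smul_apply, ContinuousLinearMap.proj_apply, smul_eq_mul]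
  ring

theorem continuousAt_laurent {a : P.Pt → ℂ} (ha : ∀ v, a v ≠ 0) (m : P.Pt → ℤ) :
    ContinuousAt (laurent m) a :=
  (hasFDerivAt_laurent ha m).continuousAt

variable {r : ℕ} (l : Module.Basis (Fin r) ℤ (relationLattice P))

theorem relation_eq_sum_repr (ℓ : relationLattice P) : ℓ.1 = ∑ j, l.repr ℓ j • (l j).1 := by
  have hsum := congrArg Subtype.val (l.sum_repr ℓ)
  simpa only [Submodule.coe_sum, Submodule.coe_smul] using hsum.symm

/-- A bound, in `ℓ¹`-norms, for the change of coordinates from the basis `l` to the standard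
coordinates, see `oneNorm_le_basisSize_mul`. -/
def basisSize : ℕ := ∑ j, oneNorm (l j).1

theorem oneNorm_le_basisSize_mul (ℓ : relationLattice P) :
    oneNorm ℓ.1 ≤ basisSize l * oneNorm (l.repr ℓ) := by
  calc oneNorm ℓ.1 ≤ ∑ v, ∑ j, (l.repr ℓ j).natAbs * ((l j).1 v).natAbs := by
        refine Finset.sum_le_sum fun v _ => ?_
        rw [relation_eq_sum_repr l ℓ, Finset.sum_apply]
        simpa only [Pi.smul_apply, smul_eq_mul, Int.natAbs_mul] using
          Int.natAbs_sum_le Finset.univ fun j => (l.repr ℓ j • (l j).1) v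
    _ = ∑ j, oneNorm (l j).1 * (l.repr ℓ j).natAbs := by
        rw [Finset.sum_comm]
        simp only [oneNorm, Finset.sum_mul, mul_comm]
    _ ≤ ∑ j, basisSize l * (l.repr ℓ j).natAbs := by
        gcongr with j
        exact Finset.single_le_sum (f := fun j => oneNorm (l j).1) (fun _ _ => Nat.zero_le _)
          (Finset.mem_univ j)
    _ = _ := by rw [← Finset.mul_sum, oneNorm]

theorem norm_laurent_le_pow_oneNorm {δ : ℝ} {a : P.Pt → ℂ} (ha : a ∈ lcslNhd P l δ)
    {ℓ : relationLattice P} (hℓ : ∀ j, 0 ≤ l.repr ℓ j) :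
    ‖laurent ℓ.1 a‖ ≤ δ ^ oneNorm (l.repr ℓ) := by
  rw [relation_eq_sum_repr l ℓ, laurent_sum_zsmul _ ha.1, norm_prod, oneNorm,
    ← Finset.prod_pow_eq_pow_sum]
  refine Finset.prod_le_prod (fun _ _ => norm_nonneg _) fun j _ => ?_
  rw [← Int.natAbs_of_nonneg (hℓ j), zpow_natCast, norm_pow, Int.natAbs_natCast]
  exact pow_le_pow_left₀ (norm_nonneg _) (ha.2 j).le _

theorem oneNorm_le_oneNorm_neg_add (ℓ κ : relationLattice P) :
    oneNorm ℓ.1 ≤ oneNorm (-κ.1) + basisSize l * oneNorm (l.repr (ℓ + κ)) := by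
  have hadd := oneNorm_add_le (-κ.1) (ℓ + κ).1
  rw [show -κ.1 + (ℓ + κ).1 = ℓ.1 by rw [Submodule.coe_add]; abel] at hadd
  exact hadd.trans (Nat.add_le_add_left (oneNorm_le_basisSize_mul l _) _)

theorem norm_laurent_add_le {δ : ℝ} {a : P.Pt → ℂ} (ha : a ∈ lcslNhd P l δ) (γ : P.Pt → ℤ)
    {ℓ κ : relationLattice P} (hℓ : ∀ j, 0 ≤ l.repr (ℓ + κ) j) :
    ‖laurent (γ + ℓ.1) a‖ ≤ ‖laurent (γ - κ.1) a‖ * δ ^ oneNorm (l.repr (ℓ + κ)) := by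
  rw [show γ + ℓ.1 = (γ - κ.1) + (ℓ + κ).1 by rw [Submodule.coe_add]; abel, laurent_add ha.1,
    norm_mul]
  gcongr
  exact norm_laurent_le_pow_oneNorm l ha hℓ

theorem isOpen_lcslNhd (ε : ℝ) : IsOpen (lcslNhd P l ε) := by
  refine isOpen_iff_mem_nhds.2 fun a ha => ?_
  have hsmall : ∀ᶠ y in nhds a, ∀ j, ‖laurent (l j).1 y‖ < ε :=
    Filter.eventually_all.2 fun j =>
      (continuousAt_laurent ha.1 (l j).1).norm.eventually_lt_const (ha.2 j)
  filter_upwards [isOpen_forall_ne_zero.mem_nhds ha.1, hsmall] with y hy0 hy using ⟨hy0, hy⟩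

theorem exists_mem_lcslNhd_mul {ε : ℝ} (hε : 0 < ε) {a : P.Pt → ℂ} (ha : a ∈ lcslNhd P l ε) :
    ∃ ρ : ℝ, 0 < ρ ∧ ρ < 1 ∧ a ∈ lcslNhd P l (ρ * ε) := by
  have hsmall : ∀ᶠ ρ : ℝ in nhdsWithin 1 (Set.Iio 1), ∀ j, ‖laurent (l j).1 a‖ / ε < ρ :=
    Filter.eventually_all.2 fun j =>
      Filter.Eventually.filter_mono nhdsWithin_le_nhds
        (eventually_gt_nhds ((div_lt_one hε).2 (ha.2 j)))
  have hpos : ∀ᶠ ρ : ℝ in nhdsWithin 1 (Set.Iio 1), 0 < ρ :=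
    Filter.Eventually.filter_mono nhdsWithin_le_nhds (eventually_gt_nhds one_pos)
  obtain ⟨ρ, hρ, hρ0, hρ1⟩ :=
    (hsmall.and (hpos.and eventually_mem_nhdsWithin)).exists
  exact ⟨ρ, hρ0, hρ1, ha.1, fun j => (div_lt_iff₀ hε).1 (hρ j)⟩

end LaurentMonomials

/-! ### Laurent series -/

section LaurentSeries

theorem summable_pow_oneNorm (r : ℕ) {ρ : ℝ} (hρ0 : 0 ≤ ρ) (hρ1 : ρ < 1) :
    Summable fun k : Fin r → ℤ => ρ ^ oneNorm k := by
  induction r with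
  | zero => exact (hasSum_fintype _).summable
  | succ r ih =>
    have hint : Summable fun m : ℤ => ρ ^ m.natAbs :=
      .of_nat_of_neg (by simpa using summable_geometric_of_lt_one hρ0 hρ1)
        (by simpa using summable_geometric_of_lt_one hρ0 hρ1)
    rw [← (Fin.consEquiv fun _ => ℤ).summable_iff]
    refine (hint.mul_of_nonneg ih (fun _ => by positivity) fun _ => by positivity).congr
      fun x => ?_
    simp [oneNorm, Fin.sum_univ_succ, Fin.consEquiv, pow_add]

variable {n : ℕ} {P : ReflexivePolytope n} {r : ℕ}
  (l : Module.Basis (Fin r) ℤ (relationLattice P))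

theorem summable_pow_oneNorm_repr {ρ : ℝ} (hρ0 : 0 ≤ ρ) (hρ1 : ρ < 1) :
    Summable fun ℓ : relationLattice P => ρ ^ oneNorm (l.repr ℓ) :=
  (l.equivFun.toEquiv.summable_iff (f := fun k => ρ ^ oneNorm k)).2
    (summable_pow_oneNorm r hρ0 hρ1)

/-- A radius of convergence, in the coordinates `a^{l_j}`, for Laurent series with coefficients of
size `O(Q ^ |ℓ|)`. The factor `2` leaves room for the polynomial factors produced by
differentiation. -/
def convRadius (Q : ℝ) : ℝ := ((2 * Q) ^ basisSize l)⁻¹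

theorem convRadius_pos {Q : ℝ} (hQ : 1 ≤ Q) : 0 < convRadius l Q := by
  unfold convRadius; positivity

variable {E : Type*} [NormedAddCommGroup E]

/-- Coefficients indexed by the relation lattice, of size `O(Q ^ |ℓ|)` and supported in a translate
of the orthant spanned by the basis `l`. -/
structure IsDominated (Q : ℝ) (b : relationLattice P → E) : Prop where
  growth : ∃ C : ℝ, ∀ ℓ, ‖b ℓ‖ ≤ C * Q ^ oneNorm ℓ.1
  support : ∃ K : ℕ, ∀ ℓ, b ℓ ≠ 0 → ∀ j, -(K : ℤ) ≤ l.repr ℓ j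

theorem IsDominated.mono {l : Module.Basis (Fin r) ℤ (relationLattice P)} {Q Q' : ℝ}
    {b : relationLattice P → E} (hb : IsDominated l Q b) (hQ : 1 ≤ Q) (hQQ' : Q ≤ Q') :
    IsDominated l Q' b := by
  obtain ⟨⟨C, hC⟩, hsupp⟩ := hb
  refine ⟨⟨|C|, fun ℓ => (hC ℓ).trans ?_⟩, hsupp⟩
  gcongr
  exact le_abs_self C

variable [NormedSpace ℂ E] {Q : ℝ} {b : relationLattice P → E} {l}

theorem IsDominated.exists_summable_bound (hb : IsDominated l Q b) (hQ : 1 ≤ Q) (γ : P.Pt → ℤ)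
    {a : P.Pt → ℂ} (ha : a ∈ lcslNhd P l (convRadius l Q)) :
    ∃ u : relationLattice P → ℝ, Summable u ∧ ∀ᶠ y in nhds a, ∀ ℓ,
      2 ^ oneNorm ℓ.1 * ‖laurent (γ + ℓ.1) y • b ℓ‖ ≤ u ℓ := by
  have hε := convRadius_pos l hQ
  obtain ⟨ρ, hρ0, hρ1, haρ⟩ := exists_mem_lcslNhd_mul l hε ha
  obtain ⟨⟨C, hgrowth⟩, K, hsupp⟩ := hb
  have hC : 0 ≤ C := by simpa [oneNorm] using (norm_nonneg _).trans (hgrowth 0)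
  set κ : relationLattice P := (K : ℤ) • ∑ j, l j with hκ
  have hκ_repr (j) : l.repr κ j = K := by
    simp [hκ, Finsupp.single_apply]
  set B := ‖laurent (γ - κ.1) a‖ + 1
  refine ⟨fun ℓ => C * B * (2 * Q) ^ oneNorm (-κ.1) * ρ ^ oneNorm (l.repr (ℓ + κ)),
    ((Equiv.addRight κ).summable_iff.2 (summable_pow_oneNorm_repr l hρ0.le hρ1)).mul_left _, ?_⟩
  filter_upwards [(isOpen_lcslNhd l _).mem_nhds haρ,
    (continuousAt_laurent ha.1 (γ - κ.1)).norm.eventually_lt_const (lt_add_one _)] with y hy hyB ℓ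
  by_cases hℓ : b ℓ = 0
  · rw [hℓ, smul_zero, norm_zero, mul_zero]
    positivity
  have hpos (j) : 0 ≤ l.repr (ℓ + κ) j := by
    rw [map_add, Finsupp.add_apply, hκ_repr]
    linarith [hsupp ℓ hℓ j]
  have hlaurent : ‖laurent (γ + ℓ.1) y‖ ≤ B * (ρ * convRadius l Q) ^ oneNorm (l.repr (ℓ + κ)) :=
    (norm_laurent_add_le l hy γ hpos).trans (by gcongr)
  have hsize := oneNorm_le_oneNorm_neg_add l ℓ κ
  set N := oneNorm (l.repr (ℓ + κ))
  calc 2 ^ oneNorm ℓ.1 * ‖laurent (γ + ℓ.1) y • b ℓ‖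
      ≤ 2 ^ oneNorm ℓ.1 * ((B * (ρ * convRadius l Q) ^ N) * (C * Q ^ oneNorm ℓ.1)) := by
        rw [norm_smul]
        gcongr
        exact hgrowth ℓ
    _ = C * B * (2 * Q) ^ oneNorm ℓ.1 * (ρ * convRadius l Q) ^ N := by rw [mul_pow]; ring
    _ ≤ C * B * (2 * Q) ^ (oneNorm (-κ.1) + basisSize l * N) * (ρ * convRadius l Q) ^ N := by
        gcongr
        linarith
    _ = C * B * (2 * Q) ^ oneNorm (-κ.1) * ρ ^ N := by
        rw [pow_add, pow_mul, mul_pow ρ, convRadius, inv_pow]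
        field_simp

/-- The Laurent series `∑_ℓ b_ℓ a^{γ + ℓ}` over the relation lattice. -/
def laurentSeries (b : relationLattice P → E) (γ : P.Pt → ℤ) (a : P.Pt → ℂ) : E :=
  ∑' ℓ : relationLattice P, laurent (γ + ℓ.1) a • b ℓ

theorem abs_add_le_mul_two_pow_oneNorm {ι : Type*} [Fintype ι] (c : ℤ) (m : ι → ℤ) (v : ι) :
    ((|c + m v| : ℤ) : ℝ) ≤ (|(c : ℝ)| + 1) * 2 ^ oneNorm m := by
  have hm : ((|m v| : ℤ) : ℝ) ≤ 2 ^ oneNorm m := by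
    rw [Int.abs_eq_natAbs]
    exact_mod_cast (natAbs_le_oneNorm m v).trans Nat.lt_two_pow_self.le
  have hone : (1 : ℝ) ≤ 2 ^ oneNorm m := one_le_pow₀ one_le_two
  push_cast at hm ⊢
  nlinarith [abs_add_le (c : ℝ) (m v), abs_nonneg (c : ℝ)]

variable [CompleteSpace E]

theorem IsDominated.summable_laurentSeries (hb : IsDominated l Q b) (hQ : 1 ≤ Q) (γ : P.Pt → ℤ)
    {a : P.Pt → ℂ} (ha : a ∈ lcslNhd P l (convRadius l Q)) :
    Summable fun ℓ : relationLattice P => laurent (γ + ℓ.1) a • b ℓ := by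
  obtain ⟨u, hu, hbound⟩ := hb.exists_summable_bound hQ γ ha
  exact Summable.of_norm_bounded hu fun ℓ =>
    (le_mul_of_one_le_left (norm_nonneg _) (one_le_pow₀ one_le_two)).trans
      (hbound.self_of_nhds ℓ)

theorem IsDominated.hasFDerivAt_laurentSeries (hb : IsDominated l Q b) (hQ : 1 ≤ Q)
    (γ : P.Pt → ℤ) {a : P.Pt → ℂ} (ha : a ∈ lcslNhd P l (convRadius l Q)) :
    HasFDerivAt (laurentSeries b γ) (ofPartials fun v =>
      laurentSeries (fun ℓ => ((γ v + ℓ.1 v : ℤ) : ℂ) • b ℓ) (γ - Pi.single v 1) a) a := by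
  choose u hu hbound using fun v : P.Pt => hb.exists_summable_bound hQ (γ - Pi.single v 1) ha
  obtain ⟨s, hs, hball⟩ := Metric.eventually_nhds_iff_ball.1
    ((Filter.eventually_all.2 hbound).and ((isOpen_lcslNhd l _).mem_nhds ha))
  let derivTerm (ℓ : relationLattice P) (y : P.Pt → ℂ) (v : P.Pt) : E :=
    laurent (γ - Pi.single v 1 + ℓ.1) y • ((γ v + ℓ.1 v : ℤ) : ℂ) • b ℓ
  have hderiv : ∀ ℓ : relationLattice P, ∀ y ∈ Metric.ball a s,
      HasFDerivAt (fun y => laurent (γ + ℓ.1) y • b ℓ) (ofPartials (derivTerm ℓ y)) y := by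
    intro ℓ y hy
    convert! (hasFDerivAt_laurent (hball y hy).2.1 (γ + ℓ.1)).smul_const (b ℓ) using 1
    ext x
    simp only [ofPartials_apply, ContinuousLinearMap.smulRight_apply, Finset.sum_smul, derivTerm,
      smul_smul, smul_eq_mul, Pi.add_apply, add_sub_right_comm, mul_comm]
  have hterm_le : ∀ ℓ : relationLattice P, ∀ y ∈ Metric.ball a s, ∀ v,
      ‖derivTerm ℓ y v‖ ≤ (|(γ v : ℝ)| + 1) * u v ℓ := by
    intro ℓ y hy v
    simp only [derivTerm]
    rw [smul_comm, norm_smul, Complex.norm_intCast, ← Int.cast_abs]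
    calc _ ≤ (|(γ v : ℝ)| + 1) * 2 ^ oneNorm ℓ.1 *
          ‖laurent (γ - Pi.single v 1 + ℓ.1) y • b ℓ‖ := by
          gcongr
          exact abs_add_le_mul_two_pow_oneNorm _ _ _
      _ ≤ _ := by
          rw [mul_assoc]
          gcongr
          exact (hball y hy).1 v ℓ
  have ha_ball := Metric.mem_ball_self (x := a) hs
  have hterm_sum (v : P.Pt) : Summable fun ℓ : relationLattice P => derivTerm ℓ a v :=
    Summable.of_norm_bounded ((hu v).mul_left _) fun ℓ => hterm_le ℓ a ha_ball v
  convert! hasFDerivAt_tsum_of_isPreconnected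
    (summable_sum fun v _ => (hu v).mul_left (|(γ v : ℝ)| + 1)) Metric.isOpen_ball
    (convex_ball a s).isPreconnected hderiv
    (fun ℓ y hy => (norm_ofPartials_le _).trans (Finset.sum_le_sum fun v _ => hterm_le ℓ y hy v))
    ha_ball (hb.summable_laurentSeries hQ γ ha) ha_ball using 1
  exact (hasSum_ofPartials fun v => (hterm_sum v).hasSum).tsum_eq.symm

end LaurentSeries

/-! ### Hypergeometric series -/

section HyperSeries

variable {n : ℕ} {P : ReflexivePolytope n} {U : Set (P.Pt → ℂ)} {lg : (P.Pt → ℂ) → P.Pt → ℂ}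

theorem IsLogBranch.hasFDerivAt (h : IsLogBranch U lg) (hU : IsOpen U) {a : P.Pt → ℂ} (ha : a ∈ U)
    (v : P.Pt) :
    HasFDerivAt (fun y => lg y v)
      ((a v)⁻¹ • ContinuousLinearMap.proj (R := ℂ) (φ := fun _ : P.Pt => ℂ) v) a := by
  have hlg : DifferentiableAt ℂ (fun y => lg y v) a :=
    differentiableAt_pi.1 (h.holomorphic.differentiableAt (hU.mem_nhds ha)) v
  have hexp : (fun y => Complex.exp (lg y v)) =ᶠ[nhds a] fun y => y v := by
    filter_upwards [hU.mem_nhds ha] with y hy using h.exp_eq y hy v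
  have hderiv :=
    hlg.hasFDerivAt.cexp.unique ((hasFDerivAt_apply (𝕜 := ℂ) v a).congr_of_eventuallyEq hexp)
  have hav : a v ≠ 0 := h.exp_eq a ha v ▸ Complex.exp_ne_zero _
  rw [h.exp_eq a ha v] at hderiv
  rw [← hderiv, smul_smul, inv_mul_cancel₀ hav, one_smul]
  exact hlg.hasFDerivAt

variable {R : Type*} [NormedCommRing R] [NormedAlgebra ℂ R]

theorem IsLogBranch.hasFDerivAt_exp [CompleteSpace R] (h : IsLogBranch U lg) (hU : IsOpen U)
    {a : P.Pt → ℂ} (ha : a ∈ U) (D : P.Pt → R) :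
    HasFDerivAt (fun y => NormedSpace.exp (∑ v, lg y v • D v))
      (ofPartials fun v => (a v)⁻¹ • (D v * NormedSpace.exp (∑ v, lg a v • D v))) a := by
  have hsum : HasFDerivAt (fun y => ∑ v, lg y v • D v)
      (∑ v, ((a v)⁻¹ • ContinuousLinearMap.proj (R := ℂ) (φ := fun _ : P.Pt => ℂ) v).smulRight
        (D v)) a := HasFDerivAt.fun_sum fun v _ => (h.hasFDerivAt hU ha v).smul_const (D v)
  refine ((_root_.hasFDerivAt_exp (𝕂 := ℂ)).comp a hsum).congr_fderiv ?_
  ext x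
  simp only [ofPartials_apply, ContinuousLinearMap.comp_apply, sum_apply,
    ContinuousLinearMap.smulRight_apply, smul_apply, one_apply_eq_self,
    ContinuousLinearMap.proj_apply, smul_eq_mul, Finset.mul_sum]
  refine Finset.sum_congr rfl fun v _ => ?_
  rw [mul_smul_comm, mul_comm _ (D v), smul_smul, mul_comm (x v)]

/-- The sum `∑_m ∏_v Γ(D_v + 1) / Γ(D_v + m_v + 1) a^m` over `m ∈ γ + L`. -/
def gammaSeries (D : P.Pt → R) (γ : P.Pt → ℤ) : (P.Pt → ℂ) → R :=
  laurentSeries (fun ℓ => gammaCoeff D (γ + ℓ.1)) γ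

theorem gammaSeries_eq_of_sub_mem (D : P.Pt → R) {γ δ : P.Pt → ℤ}
    (h : γ - δ ∈ relationLattice P) : gammaSeries D γ = gammaSeries D δ := by
  funext a
  unfold gammaSeries laurentSeries
  rw [← (Equiv.addRight (⟨γ - δ, h⟩ : relationLattice P)).tsum_eq
    fun ℓ : relationLattice P => laurent (δ + ℓ.1) a • gammaCoeff D (δ + ℓ.1)]
  refine tsum_congr fun ℓ => ?_
  rw [show δ + ((Equiv.addRight (⟨γ - δ, h⟩ : relationLattice P)) ℓ).1 = γ + ℓ.1 by
    change δ + (ℓ.1 + (γ - δ)) = γ + ℓ.1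
    abel]

/-- The hypergeometric series `∑_m ∏_v Γ(D_v + 1) / Γ(D_v + m_v + 1) a^{m + D}`, the sum being over
`m ∈ γ + L`, for the given choice `lg` of the logarithms in `a^D`. -/
def hyperSeries (D : P.Pt → R) (lg : (P.Pt → ℂ) → P.Pt → ℂ) (γ : P.Pt → ℤ) (a : P.Pt → ℂ) : R :=
  gammaSeries D γ a * NormedSpace.exp (∑ v, lg a v • D v)

theorem hyperSeries_eq_of_sub_mem (D : P.Pt → R) (lg : (P.Pt → ℂ) → P.Pt → ℂ) {γ δ : P.Pt → ℤ}
    (h : γ - δ ∈ relationLattice P) : hyperSeries D lg γ = hyperSeries D lg δ := by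
  unfold hyperSeries
  rw [gammaSeries_eq_of_sub_mem D h]

variable [CompleteSpace R] {D : P.Pt → R} {r : ℕ}
  {l : Module.Basis (Fin r) ℤ (relationLattice P)} {Q : ℝ}

theorem hasSum_gammaSeries {γ : P.Pt → ℤ} (hQ : 1 ≤ Q)
    (hdom : IsDominated l Q fun ℓ => gammaCoeff D (γ + ℓ.1)) {a : P.Pt → ℂ}
    (ha : a ∈ lcslNhd P l (convRadius l Q)) :
    HasSum (fun ℓ : relationLattice P => laurent (γ + ℓ.1) a • gammaCoeff D (γ + ℓ.1))
      (gammaSeries D γ a) :=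
  (hdom.summable_laurentSeries hQ γ ha).hasSum

variable (hD : ∀ v, ∀ k : ℕ, IsUnit (D v + ((k + 1 : ℕ) : R))) (hQ : 1 ≤ Q)
  (hdom : ∀ γ : P.Pt → ℤ, IsDominated l Q fun ℓ => gammaCoeff D (γ + ℓ.1))

include hD hQ hdom

theorem hasSum_mul_gammaSeries_sub_single (γ : P.Pt → ℤ) {a : P.Pt → ℂ}
    (ha : a ∈ lcslNhd P l (convRadius l Q)) (v : P.Pt) :
    HasSum (fun ℓ : relationLattice P => laurent (γ + ℓ.1) a •
      ((D v + ((γ v + ℓ.1 v : ℤ) : R)) * gammaCoeff D (γ + ℓ.1)))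
      (a v • gammaSeries D (γ - Pi.single v 1) a) := by
  refine ((hasSum_gammaSeries hQ (hdom (γ - Pi.single v 1)) ha).const_smul (a v)).congr_fun
    fun ℓ => ?_
  rw [← add_sub_right_comm, gammaCoeff_sub_single hD, smul_smul, mul_laurent_sub_single ha.1,
    Pi.add_apply]

theorem hasFDerivAt_gammaSeries (γ : P.Pt → ℤ) {a : P.Pt → ℂ}
    (ha : a ∈ lcslNhd P l (convRadius l Q)) :
    HasFDerivAt (gammaSeries D γ) (ofPartials fun v =>
      gammaSeries D (γ - Pi.single v 1) a - (a v)⁻¹ • (gammaSeries D γ a * D v)) a := by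
  refine ((hdom γ).hasFDerivAt_laurentSeries hQ γ ha).congr_fderiv (congrArg _ (funext fun v => ?_))
  have hav := ha.1 v
  have hshift := hasSum_mul_gammaSeries_sub_single hD hQ hdom γ ha v
  have hmul := (hasSum_gammaSeries hQ (hdom γ) ha).mul_right (D v)
  have hdiff := (hshift.sub hmul).const_smul (a v)⁻¹
  rw [smul_sub, inv_smul_smul₀ hav] at hdiff
  refine (hdiff.congr_fun fun ℓ => ?_).tsum_eq
  rw [smul_mul_assoc, ← smul_sub, mul_comm _ (D v), add_mul, add_sub_cancel_left,
    ← mul_laurent_sub_single ha.1 (γ + ℓ.1) v, mul_smul, inv_smul_smul₀ hav,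
    add_sub_right_comm, ← zsmul_eq_mul, ← Int.cast_smul_eq_zsmul ℂ]

theorem hasFDerivAt_hyperSeries (hU : IsOpen U) (hUl : U ⊆ lcslNhd P l (convRadius l Q))
    (hlg : IsLogBranch U lg) (γ : P.Pt → ℤ) {a : P.Pt → ℂ} (ha : a ∈ U) :
    HasFDerivAt (hyperSeries D lg γ)
      (ofPartials fun v => hyperSeries D lg (γ - Pi.single v 1) a) a := by
  refine ((hasFDerivAt_gammaSeries hD hQ hdom γ (hUl ha)).mul
    (hlg.hasFDerivAt_exp hU ha D)).congr_fderiv ?_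
  rw [eq_ofPartials (_ + _)]
  refine congrArg _ (funext fun v => ?_)
  simp only [add_apply, smul_apply, ofPartials_single, hyperSeries, smul_eq_mul]
  rw [mul_smul_comm, mul_sub, mul_smul_comm, mul_comm (NormedSpace.exp _) (_ * D v), mul_assoc,
    add_sub_cancel, mul_comm]

theorem sum_smul_gammaSeries {β : P.Pt → ℂ} {κ : ℂ} {δ : P.Pt → ℤ}
    (hβL : ∀ ℓ ∈ relationLattice P, ∑ v, β v * (ℓ v : ℂ) = 0)
    (hβδ : ∑ v, β v * (δ v : ℂ) = κ) (hβD : ∑ v, β v • D v = 0) {a : P.Pt → ℂ}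
    (ha : a ∈ lcslNhd P l (convRadius l Q)) :
    ∑ v, (β v * a v) • gammaSeries D (δ - Pi.single v 1) a = κ • gammaSeries D δ a := by
  have hcoeff (ℓ : relationLattice P) :
      ∑ v, β v • (D v + ((δ v + ℓ.1 v : ℤ) : R)) = κ • (1 : R) := by
    have hcast (v : P.Pt) : β v • ((δ v + ℓ.1 v : ℤ) : R) =
        (β v * (δ v : ℂ) + β v * (ℓ.1 v : ℂ)) • (1 : R) := by
      rw [← mul_add, mul_smul, ← Int.cast_add, Int.cast_smul_eq_zsmul, zsmul_one]
    simp only [smul_add, Finset.sum_add_distrib, hβD, hcast, ← Finset.sum_smul, hβδ,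
      hβL _ ℓ.2, add_zero, zero_add]
  have hsum := hasSum_sum (s := Finset.univ) fun v _ =>
    (hasSum_mul_gammaSeries_sub_single hD hQ hdom δ ha v).const_smul (β v)
  simp only [mul_smul]
  refine hsum.unique (((hasSum_gammaSeries hQ (hdom δ) ha).const_smul κ).congr_fun fun ℓ => ?_)
  calc ∑ v, β v • laurent (δ + ℓ.1) a • ((D v + ((δ v + ℓ.1 v : ℤ) : R)) * gammaCoeff D (δ + ℓ.1))
      = laurent (δ + ℓ.1) a •
        ((∑ v, β v • (D v + ((δ v + ℓ.1 v : ℤ) : R))) * gammaCoeff D (δ + ℓ.1)) := by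
        simp only [Finset.sum_mul, Finset.smul_sum, smul_comm (β _) (laurent _ _), smul_mul_assoc]
    _ = κ • laurent (δ + ℓ.1) a • gammaCoeff D (δ + ℓ.1) := by
        rw [hcoeff, smul_mul_assoc, one_mul, smul_comm]

theorem sum_smul_hyperSeries {β : P.Pt → ℂ} {κ : ℂ} {δ : P.Pt → ℤ}
    (hβL : ∀ ℓ ∈ relationLattice P, ∑ v, β v * (ℓ v : ℂ) = 0)
    (hβδ : ∑ v, β v * (δ v : ℂ) = κ) (hβD : ∑ v, β v • D v = 0) {a : P.Pt → ℂ}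
    (ha : a ∈ lcslNhd P l (convRadius l Q)) :
    ∑ v, (β v * a v) • hyperSeries D lg (δ - Pi.single v 1) a = κ • hyperSeries D lg δ a := by
  simp only [hyperSeries, ← smul_mul_assoc, ← Finset.sum_mul,
    sum_smul_gammaSeries hD hQ hdom hβL hβδ hβD ha]

end HyperSeries

/-! ### The differential equations -/

section AffineWeights

variable {n : ℕ} {P : ReflexivePolytope n}

theorem mem_relationLattice_iff {ℓ : P.Pt → ℤ} :
    ℓ ∈ relationLattice P ↔ (∀ j : Fin n, ∑ v, ℓ v * v.1 j = 0) ∧ ∑ v, ℓ v = 0 := Iff.rfl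

theorem sum_mul_affine_eq_zero {A : Type*} [CommRing A] {ℓ : P.Pt → ℤ}
    (hℓ : ℓ ∈ relationLattice P) (c : A) (m : Fin n → A) :
    ∑ v, (ℓ v : A) * (c + m ⬝ᵥ fun j => (v.1 j : A)) = 0 := by
  obtain ⟨hlin, hsum⟩ := mem_relationLattice_iff.1 hℓ
  have hlin' (j : Fin n) : ∑ v : P.Pt, (ℓ v : A) * (v.1 j : A) = 0 := by
    exact_mod_cast congrArg (Int.cast (R := A)) (hlin j)
  have hsum' : ∑ v, (ℓ v : A) = 0 := by exact_mod_cast congrArg (Int.cast (R := A)) hsum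
  simp only [dotProduct, mul_add, Finset.sum_add_distrib, ← Finset.sum_mul, hsum', zero_mul,
    zero_add, Finset.mul_sum, mul_left_comm _ (m _)]
  rw [Finset.sum_comm]
  simp only [← Finset.mul_sum, hlin', mul_zero, Finset.sum_const_zero]

theorem sum_affine_smul_eq_zero {A M : Type*} [CommRing A] [AddCommGroup M] [Module A M]
    {D : P.Pt → M} (hsum : ∑ v, D v = 0) (hlin : ∀ j : Fin n, ∑ v : P.Pt, (v.1 j : A) • D v = 0)
    (c : A) (m : Fin n → A) : ∑ v, (c + m ⬝ᵥ fun j => (v.1 j : A)) • D v = 0 := by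
  simp only [dotProduct, add_smul, Finset.sum_add_distrib, ← Finset.smul_sum, hsum, smul_zero,
    zero_add, Finset.sum_smul, mul_smul]
  rw [Finset.sum_comm]
  simp only [← Finset.smul_sum, hlin, smul_zero, Finset.sum_const_zero]

theorem single_sub_single_mem_relationLattice {v w v' w' : P.Pt} (h : v.1 + w.1 = v'.1 + w'.1) :
    Pi.single v 1 + Pi.single w 1 - (Pi.single v' 1 + Pi.single w' 1) ∈ relationLattice P := by
  refine mem_relationLattice_iff.2 ⟨fun j => ?_, by simp [Finset.sum_add_distrib, Pi.single_apply]⟩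
  have hj := congrFun h j
  simp only [Pi.add_apply] at hj
  simp only [Pi.sub_apply, Pi.add_apply, sub_mul, add_mul, Finset.sum_sub_distrib,
    Finset.sum_add_distrib, Pi.single_apply, ite_mul, one_mul, zero_mul, Finset.sum_ite_eq',
    Finset.mem_univ, if_true]
  omega

theorem rootOperator_eq_sum {u v : Fin n → ℤ} {w : P.Pt → P.Pt}
    (hw : ∀ v' : P.Pt, v'.1 ⬝ᵥ u ≠ -1 → (w v').1 = v'.1 + v) (f : (P.Pt → ℂ) → ℂ) (a : P.Pt → ℂ) :
    rootOperator P u v f a =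
      ∑ v' : P.Pt, ((v'.1 ⬝ᵥ u + 1 : ℤ) : ℂ) * a v' * partialDeriv (w v') f a := by
  refine Finset.sum_congr rfl fun v' _ => ?_
  by_cases hv' : v'.1 ⬝ᵥ u = -1
  · simp [hv']
  rw [Finset.sum_eq_single_of_mem (w v') (by simpa [hv'] using hw v' hv')]
  intro x hx hxw
  exact absurd (Subtype.ext ((Finset.mem_filter.1 hx).2.2.trans (hw v' hv').symm)) hxw

end AffineWeights

section Solutions

variable {n : ℕ} {P : ReflexivePolytope n} {R : Type*} [NormedCommRing R] [NormedAlgebra ℂ R]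
  [CompleteSpace R] {D : P.Pt → R} {r : ℕ} {l : Module.Basis (Fin r) ℤ (relationLattice P)} {Q : ℝ}
  {U : Set (P.Pt → ℂ)} {lg : (P.Pt → ℂ) → P.Pt → ℂ} (φ : R →L[ℂ] ℂ) {f : (P.Pt → ℂ) → ℂ}
  (hD : ∀ v, ∀ k : ℕ, IsUnit (D v + ((k + 1 : ℕ) : R))) (hQ : 1 ≤ Q)
  (hdom : ∀ γ : P.Pt → ℤ, IsDominated l Q fun ℓ => gammaCoeff D (γ + ℓ.1))
  (hU : IsOpen U) (hUl : U ⊆ lcslNhd P l (convRadius l Q)) (hlg : IsLogBranch U lg)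

include hD hQ hdom hU hUl hlg

theorem hasFDerivAt_of_eqOn_hyperSeries {γ : P.Pt → ℤ}
    (hf : Set.EqOn f (fun a => φ (hyperSeries D lg γ a)) U) {a : P.Pt → ℂ} (ha : a ∈ U) :
    HasFDerivAt f (φ.comp (ofPartials fun v => hyperSeries D lg (γ - Pi.single v 1) a)) a :=
  (φ.hasFDerivAt.comp a (hasFDerivAt_hyperSeries hD hQ hdom hU hUl hlg γ ha)).congr_of_eventuallyEq
    (hf.eventuallyEq_of_mem (hU.mem_nhds ha))

theorem partialDeriv_eqOn {γ : P.Pt → ℤ} (hf : Set.EqOn f (fun a => φ (hyperSeries D lg γ a)) U)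
    (v : P.Pt) :
    Set.EqOn (partialDeriv v f) (fun a => φ (hyperSeries D lg (γ - Pi.single v 1) a)) U := by
  intro a ha
  rw [partialDeriv, (hasFDerivAt_of_eqOn_hyperSeries φ hD hQ hdom hU hUl hlg hf ha).fderiv,
    ContinuousLinearMap.comp_apply, ofPartials_single]

theorem iterate_partialDeriv_eqOn {γ : P.Pt → ℤ}
    (hf : Set.EqOn f (fun a => φ (hyperSeries D lg γ a)) U) (v : P.Pt) (k : ℕ) :
    Set.EqOn ((partialDeriv v)^[k] f)
      (fun a => φ (hyperSeries D lg (γ - Pi.single v (k : ℤ)) a)) U := by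
  induction k with
  | zero => simpa using hf
  | succ k ih =>
    rw [Function.iterate_succ_apply']
    have hstep := partialDeriv_eqOn φ hD hQ hdom hU hUl hlg ih v
    rwa [sub_sub, ← Pi.single_add, ← Nat.cast_succ] at hstep

theorem mixedDeriv_eqOn {γ : P.Pt → ℤ} (hf : Set.EqOn f (fun a => φ (hyperSeries D lg γ a)) U)
    (k : P.Pt → ℕ) :
    Set.EqOn (mixedDeriv k f) (fun a => φ (hyperSeries D lg (γ - fun v => (k v : ℤ)) a)) U := by
  have hlist (t : List P.Pt) : Set.EqOn (t.foldr (fun v g => (partialDeriv v)^[k v] g) f)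
      (fun a => φ (hyperSeries D lg (γ - (t.map fun v => Pi.single v (k v : ℤ)).sum) a)) U := by
    induction t with
    | nil => simpa using hf
    | cons v t ih =>
      have hstep := iterate_partialDeriv_eqOn φ hD hQ hdom hU hUl hlg ih v (k v)
      rw [List.foldr_cons, List.map_cons, List.sum_cons, add_comm]
      rwa [sub_sub] at hstep
  have huniv := hlist (Finset.univ : Finset P.Pt).toList
  rwa [Finset.sum_map_toList, Finset.univ_sum_single fun v => (k v : ℤ)] at huniv

theorem mixedDeriv_toNat_eq {γ : P.Pt → ℤ}
    (hf : Set.EqOn f (fun a => φ (hyperSeries D lg γ a)) U) {ℓ : P.Pt → ℤ}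
    (hℓ : ℓ ∈ relationLattice P) {a : P.Pt → ℂ} (ha : a ∈ U) :
    mixedDeriv (fun v => (ℓ v).toNat) f a = mixedDeriv (fun v => (-ℓ v).toNat) f a := by
  have hdiff : (γ - fun v => ((ℓ v).toNat : ℤ)) - (γ - fun v => ((-ℓ v).toNat : ℤ)) = -ℓ := by
    funext v
    simp only [Pi.sub_apply, Pi.neg_apply]
    omega
  rw [mixedDeriv_eqOn φ hD hQ hdom hU hUl hlg hf _ ha,
    mixedDeriv_eqOn φ hD hQ hdom hU hUl hlg hf _ ha]
  dsimp only
  rw [hyperSeries_eq_of_sub_mem D lg (hdiff ▸ neg_mem hℓ)]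

omit hU hlg in
theorem sum_affine_mul_hyperSeries (hsum : ∑ v, D v = 0)
    (hlin : ∀ j : Fin n, ∑ v : P.Pt, (v.1 j : ℂ) • D v = 0) (c : ℂ) (m : Fin n → ℂ)
    (δ : P.Pt → ℤ) {a : P.Pt → ℂ} (ha : a ∈ U) :
    ∑ v : P.Pt, (c + m ⬝ᵥ fun j => (v.1 j : ℂ)) * a v *
        φ (hyperSeries D lg (δ - Pi.single v 1) a) =
      (∑ v : P.Pt, (c + m ⬝ᵥ fun j => (v.1 j : ℂ)) * (δ v : ℂ)) * φ (hyperSeries D lg δ a) := by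
  have hsmul := congrArg φ (sum_smul_hyperSeries hD hQ hdom (lg := lg) (δ := δ)
    (fun ℓ hℓ => by simpa only [mul_comm] using sum_mul_affine_eq_zero hℓ c m) rfl
    (sum_affine_smul_eq_zero hsum hlin c m) (hUl ha))
  simpa only [map_sum, map_smul, smul_eq_mul] using hsmul

theorem isGKZSolution_of_eqOn (hsum : ∑ v, D v = 0)
    (hlin : ∀ j : Fin n, ∑ v : P.Pt, (v.1 j : ℂ) • D v = 0)
    (hf : Set.EqOn f (fun a => φ (hyperSeries D lg (-Pi.single P.origin 1) a)) U) :
    IsGKZSolution P U f where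
  holomorphic a ha := (hasFDerivAt_of_eqOn_hyperSeries φ hD hQ hdom hU hUl hlg hf
    ha).differentiableAt.differentiableWithinAt
  box ℓ hℓ a ha := sub_eq_zero.2 (mixedDeriv_toNat_eq φ hD hQ hdom hU hUl hlg hf hℓ ha)
  torus j a ha := by
    simp only [partialDeriv_eqOn φ hD hQ hdom hU hUl hlg hf _ ha]
    simpa [Pi.single_apply, ReflexivePolytope.origin] using
      sum_affine_mul_hyperSeries φ hD hQ hdom hUl (lg := lg) hsum hlin 0 (Pi.single j 1)
        (-Pi.single P.origin 1) ha
  euler a ha := by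
    rw [hf ha, ← eq_neg_iff_add_eq_zero]
    simp only [partialDeriv_eqOn φ hD hQ hdom hU hUl hlg hf _ ha]
    simpa [Pi.single_apply] using
      sum_affine_mul_hyperSeries φ hD hQ hdom hUl (lg := lg) hsum hlin 1 0
        (-Pi.single P.origin 1) ha

theorem rootOperator_eq_zero_of_eqOn (hsum : ∑ v, D v = 0)
    (hlin : ∀ j : Fin n, ∑ v : P.Pt, (v.1 j : ℂ) • D v = 0)
    (hf : Set.EqOn f (fun a => φ (hyperSeries D lg (-Pi.single P.origin 1) a)) U)
    {u : Fin n → ℤ} {v : P.Pt} (hv : v.1 ⬝ᵥ u = -1) {w : P.Pt → P.Pt}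
    (hw : ∀ v' : P.Pt, v'.1 ⬝ᵥ u ≠ -1 → (w v').1 = v'.1 + v.1) {a : P.Pt → ℂ} (ha : a ∈ U) :
    rootOperator P u v.1 f a = 0 := by
  have hweight (v' : P.Pt) : ((v'.1 ⬝ᵥ u + 1 : ℤ) : ℂ) =
      1 + (fun j => (u j : ℂ)) ⬝ᵥ fun j => (v'.1 j : ℂ) := by
    rw [dotProduct_comm v'.1, add_comm]
    simp [dotProduct]
  have hshift (v' : P.Pt) (hv' : v'.1 ⬝ᵥ u ≠ -1) :
      hyperSeries D lg (-Pi.single P.origin 1 - Pi.single (w v') 1) =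
        hyperSeries D lg (-Pi.single v 1 - Pi.single v' 1) := by
    refine hyperSeries_eq_of_sub_mem D lg ?_
    rw [show ∀ x y z t : P.Pt → ℤ, -x - y - (-z - t) = z + t - (x + y) by intros; abel]
    refine single_sub_single_mem_relationLattice ?_
    rw [hw v' hv', add_comm]
    exact (zero_add _).symm
  have hzero : ∑ v' : P.Pt, ((v'.1 ⬝ᵥ u + 1 : ℤ) : ℂ) * a v' *
      φ (hyperSeries D lg (-Pi.single v 1 - Pi.single v' 1) a) = 0 := by
    simp only [hweight]
    rw [sum_affine_mul_hyperSeries φ hD hQ hdom hUl hsum hlin _ _ _ ha]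
    simp only [← hweight, Pi.neg_apply, Pi.single_apply]
    simp [hv]
  rw [rootOperator_eq_sum hw, ← hzero]
  refine Finset.sum_congr rfl fun v' _ => ?_
  by_cases hv' : v'.1 ⬝ᵥ u = -1
  · simp [hv']
  · rw [partialDeriv_eqOn φ hD hQ hdom hU hUl hlg hf _ ha]
    dsimp only
    rw [hshift v' hv']

end Solutions

/-! ### Maximal simplices of a regular projective triangulation -/

section Lattice

variable {n : ℕ}

theorem toReal_injective : Function.Injective (toReal : (Fin n → ℤ) → Fin n → ℝ) := fun v w h => by
  funext k
  simpa [toReal] using congrFun h k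

theorem toReal_zero : toReal (0 : Fin n → ℤ) = 0 := by
  ext
  simp [toReal]

theorem toReal_dotProduct (v w : Fin n → ℤ) : toReal v ⬝ᵥ toReal w = ((v ⬝ᵥ w : ℤ) : ℝ) := by
  simp [dotProduct, toReal]

theorem linearMap_eq_dotProduct {A : Type*} [CommSemiring A] (f : (Fin n → A) →ₗ[A] A)
    (x : Fin n → A) : f x = x ⬝ᵥ fun j => f (Pi.single j 1) := by
  conv_lhs => rw [← Finset.univ_sum_single x, map_sum]
  refine Finset.sum_congr rfl fun j _ => ?_
  rw [← smul_eq_mul, ← map_smul, ← Pi.single_smul, smul_eq_mul, mul_one]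

theorem dotProduct_le_of_mem_convexHull {s : Set (Fin n → ℝ)} {w : Fin n → ℝ} {c : ℝ}
    (h : ∀ x ∈ s, x ⬝ᵥ w ≤ c) {x : Fin n → ℝ} (hx : x ∈ convexHull ℝ s) : x ⬝ᵥ w ≤ c :=
  convexHull_min (t := {x | x ⬝ᵥ w ≤ c}) h (convex_halfSpace_le ⟨fun x y => add_dotProduct x y w,
    fun c x => smul_dotProduct c x w⟩ c) hx

theorem exists_supporting_functional {C : Set (Fin n → ℝ)} (hC : Convex ℝ C)
    (h0 : 0 ∈ interior C) {c : Fin n → ℝ} (hc : c ∉ interior C) :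
    ∃ u : Fin n → ℝ, (∀ x ∈ C, -1 ≤ x ⬝ᵥ u) ∧ c ⬝ᵥ u = -1 := by
  obtain ⟨f, hf0, hf⟩ := geometric_hahn_banach_of_nonempty_interior_point hC hc ⟨0, h0⟩
  have hfc : 0 < f c := by
    obtain ⟨y, hy⟩ : ∃ y, 0 < f y := by
      obtain ⟨y, hy⟩ := DFunLike.ne_iff.1 hf0
      rcases lt_or_gt_of_ne hy with h | h
      · exact ⟨-y, by simpa using h⟩
      · exact ⟨y, h⟩
    have hlim : Filter.Tendsto (fun μ : ℝ => μ • y) (nhdsWithin 0 (Set.Ioi 0)) (nhds 0) := by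
      have hcont : ContinuousAt (fun μ : ℝ => μ • y) 0 := by fun_prop
      simpa using hcont.tendsto.mono_left nhdsWithin_le_nhds
    obtain ⟨μ, hμC, hμ : 0 < μ⟩ := ((hlim.eventually_mem (mem_interior_iff_mem_nhds.1 h0)).and
      self_mem_nhdsWithin).exists
    exact (mul_pos hμ hy).trans_le (by simpa using hf _ hμC)
  have hdot (x : Fin n → ℝ) : (x ⬝ᵥ -(f c)⁻¹ • fun j => f (Pi.single j 1)) = -(f x / f c) := by
    have hfx : f x = x ⬝ᵥ fun j => f (Pi.single j 1) := linearMap_eq_dotProduct f.toLinearMap x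
    rw [dotProduct_smul, ← hfx, smul_eq_mul, neg_mul, inv_mul_eq_div]
  refine ⟨-(f c)⁻¹ • fun j => f (Pi.single j 1), fun x hx => ?_, ?_⟩
  · rw [hdot, neg_le_neg_iff]
    exact (div_le_one hfc).2 (hf x hx)
  · rw [hdot, div_self hfc.ne']

end Lattice

section Facets

variable {n : ℕ} {P : ReflexivePolytope n} {T : Geometry.SimplicialComplex ℝ (Fin n → ℝ)}
  {s : Finset (Fin n → ℝ)}

theorem card_le_of_mem_faces (hs : s ∈ T.faces) : s.card ≤ n + 1 := by
  have hcard := (T.indep hs).card_le_finrank_succ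
  have hrank : Module.finrank ℝ (vectorSpan ℝ (Set.range ((↑) : s → Fin n → ℝ))) ≤ n :=
    (Submodule.finrank_le _).trans (by simp)
  rw [Fintype.card_coe] at hcard
  omega

theorem exists_facet_superset (hs : s ∈ T.faces) : ∃ t ∈ T.facets, s ⊆ t := by
  obtain ⟨t, ⟨ht, hst⟩, hmax⟩ := (measure fun t : Finset (Fin n → ℝ) => n + 1 - t.card).wf.has_min
    {t | t ∈ T.faces ∧ s ⊆ t} ⟨s, hs, subset_rfl⟩
  refine ⟨t, ⟨ht, fun t' ht' htt' => ?_⟩, hst⟩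
  by_contra hne
  have hlt := Finset.card_lt_card (htt'.ssubset_of_ne hne)
  have hle := card_le_of_mem_faces ht'
  exact hmax t' ⟨ht', hst.trans htt'⟩ (show n + 1 - t'.card < n + 1 - t.card by omega)

variable (hT : IsRegularProjective P T)
include hT

theorem exists_facet_of_mem_carrier {x : Fin n → ℝ} (hx : x ∈ P.carrier) :
    ∃ t ∈ T.facets, x ∈ convexHull ℝ (t : Set (Fin n → ℝ)) := by
  rw [← hT.space_eq] at hx
  obtain ⟨s, hs, hxs⟩ := Geometry.SimplicialComplex.mem_space_iff.1 hx
  obtain ⟨t, ht, hst⟩ := exists_facet_superset hs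
  exact ⟨t, ht, convexHull_mono (Finset.coe_subset.2 hst) hxs⟩

theorem exists_pt_of_mem_facet (hs : s ∈ T.facets) {x : Fin n → ℝ} (hx : x ∈ s) :
    ∃ v : P.Pt, toReal v.1 = x := by
  obtain ⟨b, hb⟩ := hT.regular s hs
  have hxP : x ∈ P.carrier := hT.space_eq ▸ T.subset_space (T.facets_subset hs) hx
  rw [← Finset.mem_coe, hb] at hx
  rcases hx with rfl | ⟨k, rfl⟩
  · exact ⟨P.origin, toReal_zero⟩
  · exact ⟨⟨b k, hxP⟩, rfl⟩

theorem finite_facets : T.facets.Finite := by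
  classical
  refine (Finset.finite_toSet
    (Finset.univ.image fun v : P.Pt => toReal v.1).powerset).subset fun s hs => ?_
  rw [Finset.mem_coe, Finset.mem_powerset]
  intro x hx
  simpa using exists_pt_of_mem_facet hT hs hx

theorem origin_mem_facet (hs : s ∈ T.facets) : toReal P.origin.1 ∈ s := by
  obtain ⟨b, hb⟩ := hT.regular s hs
  rw [← Finset.mem_coe, hb]
  exact Or.inl toReal_zero

theorem exists_dual_bases_of_facet (hs : s ∈ T.facets) :
    ∃ (p : Fin n → P.Pt) (w : Fin n → Fin n → ℤ),
      (∀ v : P.Pt, toReal v.1 ∈ s ↔ v = P.origin ∨ ∃ k, v = p k) ∧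
      (∀ i k, (p i).1 ⬝ᵥ w k = if i = k then 1 else 0) ∧
      ∀ y : Fin n → ℤ, ∑ k, (y ⬝ᵥ w k) • (p k).1 = y := by
  obtain ⟨b, hb⟩ := hT.regular s hs
  have hcoord (k : Fin n) (y : Fin n → ℤ) :
      (y ⬝ᵥ fun j => b.coord k (Pi.single j 1)) = b.repr y k :=
    (linearMap_eq_dotProduct (b.coord k) y).symm
  have hbs (k : Fin n) : toReal (b k) ∈ s := by
    rw [← Finset.mem_coe, hb]
    exact Or.inr ⟨k, rfl⟩
  refine ⟨fun k => ⟨b k, hT.space_eq ▸ T.subset_space (T.facets_subset hs) (hbs k)⟩,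
    fun k j => b.coord k (Pi.single j 1), fun v => ?_, fun i k => ?_, fun y => ?_⟩
  · rw [← Finset.mem_coe, hb, Set.mem_insert_iff, Set.mem_range, ← toReal_zero,
      toReal_injective.eq_iff]
    simp only [toReal_injective.eq_iff, Subtype.ext_iff, eq_comm, ReflexivePolytope.origin]
  · rw [hcoord, b.repr_self, Finsupp.single_apply]
  · simp only [hcoord, b.sum_repr]

end Facets

/-! ### Relations that are nonnegative off a maximal simplex -/

section Relations

variable {n : ℕ} {P : ReflexivePolytope n} {T : Geometry.SimplicialComplex ℝ (Fin n → ℝ)}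
  {s : Finset (Fin n → ℝ)}

/-- `m` is nonnegative at all lattice points outside some maximal simplex of `T`. For `m` in the
relation lattice this puts `m` in the Mori cone, and only for such `m` can the coefficient of the
hypergeometric series with exponents `D_v` be nonzero. -/
def NonnegOffFacet (T : Geometry.SimplicialComplex ℝ (Fin n → ℝ)) (m : P.Pt → ℤ) : Prop :=
  ∃ s ∈ T.facets, ∀ v : P.Pt, toReal v.1 ∉ s → 0 ≤ m v

theorem NonnegOffFacet.mem_moriPoints {ℓ : P.Pt → ℤ} (h : NonnegOffFacet T ℓ)
    (hℓ : ℓ ∈ relationLattice P) : ℓ ∈ moriPoints P T := by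
  obtain ⟨s, hs, hpos⟩ := h
  refine ⟨hℓ, fun ω hω => ?_⟩
  obtain ⟨c, m, hcm⟩ := hω s hs
  have hsub : ∑ v, (ℓ v : ℝ) * ω v = ∑ v, (ℓ v : ℝ) * (ω v - (c + m ⬝ᵥ toReal v.1)) := by
    have h0 : ∑ v, (ℓ v : ℝ) * (c + m ⬝ᵥ toReal v.1) = 0 := sum_mul_affine_eq_zero hℓ c m
    simp only [mul_sub, Finset.sum_sub_distrib, h0, sub_zero]
  rw [hsub]
  refine Finset.sum_nonneg fun v _ => ?_
  by_cases hv : toReal v.1 ∈ s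
  · rw [(hcm v).2.2 hv, sub_self, mul_zero]
  · exact mul_nonneg (by exact_mod_cast hpos v hv) (sub_nonneg.2 (hcm v).1)

variable (hT : IsRegularProjective P T)
include hT

theorem NonnegOffFacet.congr {m m' : P.Pt → ℤ} (h : NonnegOffFacet T m)
    (hm : ∀ v, v ≠ P.origin → m v = m' v) : NonnegOffFacet T m' := by
  obtain ⟨s, hs, hpos⟩ := h
  refine ⟨s, hs, fun v hv => ?_⟩
  rw [← hm v fun hv0 => hv (hv0 ▸ origin_mem_facet hT hs)]
  exact hpos v hv

theorem exists_relation_eq_single_off_facet (hs : s ∈ T.facets) (v : P.Pt) :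
    ∃ ρ ∈ relationLattice P, ∀ x : P.Pt, toReal x.1 ∉ s → ρ x = (Pi.single v 1 : P.Pt → ℤ) x := by
  obtain ⟨p, w, hmem, -, hrepr⟩ := exists_dual_bases_of_facet hT hs
  set ρ : P.Pt → ℤ := Pi.single v 1 - ∑ k, Pi.single (p k) (v.1 ⬝ᵥ w k) -
    Pi.single P.origin (1 - ∑ k, v.1 ⬝ᵥ w k) with hρ
  have hsum (g : P.Pt → ℤ) : ∑ x, ρ x * g x =
      g v - ∑ k, (v.1 ⬝ᵥ w k) * g (p k) - (1 - ∑ k, v.1 ⬝ᵥ w k) * g P.origin := by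
    simp only [hρ, Pi.sub_apply, Finset.sum_apply, sub_mul (_ - _ : ℤ), sub_mul (Pi.single v 1 _),
      Finset.sum_mul, Finset.sum_sub_distrib]
    rw [Finset.sum_comm]
    simp [Pi.single_apply]
  refine ⟨ρ, mem_relationLattice_iff.2 ⟨fun j => ?_, by simpa using hsum 1⟩, fun x hx => ?_⟩
  · have hj := congrFun (hrepr v.1) j
    simp only [Finset.sum_apply, Pi.smul_apply, smul_eq_mul] at hj
    rw [hsum fun x => x.1 j, hj]
    simp [ReflexivePolytope.origin]
  · have hx0 : x ≠ P.origin := fun h => hx ((hmem x).2 (Or.inl h))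
    have hxp (k : Fin n) : x ≠ p k := fun h => hx ((hmem x).2 (Or.inr ⟨k, h⟩))
    simp only [hρ, Pi.sub_apply, Finset.sum_apply, Pi.single_eq_of_ne (hxp _),
      Pi.single_eq_of_ne hx0, Finset.sum_const_zero, sub_zero]

theorem exists_relation_eq_off_facet (hs : s ∈ T.facets) (m : P.Pt → ℤ) :
    ∃ κ : relationLattice P, ∀ v : P.Pt, toReal v.1 ∉ s → κ.1 v = m v := by
  choose ρ hρ hρ_eq using exists_relation_eq_single_off_facet hT hs
  refine ⟨⟨∑ v, m v • ρ v, Submodule.sum_smul_mem _ _ fun v _ => hρ v⟩, fun x hx => ?_⟩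
  simp [hρ_eq _ x hx, Pi.single_apply]

theorem exists_le_repr_of_nonnegOffFacet {r : ℕ} {l : Module.Basis (Fin r) ℤ (relationLattice P)}
    (hl : ∀ ℓ : relationLattice P, ℓ.1 ∈ moriPoints P T → ∀ j, 0 ≤ l.repr ℓ j) (γ : P.Pt → ℤ) :
    ∃ K : ℕ, ∀ ℓ : relationLattice P, NonnegOffFacet T (γ + ℓ.1) → ∀ j, -(K : ℤ) ≤ l.repr ℓ j := by
  have hκ : ∀ s : T.facets, ∃ κ : relationLattice P, ∀ v : P.Pt, toReal v.1 ∉ s.1 → κ.1 v = γ v :=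
    fun s => exists_relation_eq_off_facet hT s.2 γ
  choose κ hκ using hκ
  have := (finite_facets hT).to_subtype
  obtain ⟨K, hK⟩ := (Set.finite_range fun sj : T.facets × Fin r =>
    (l.repr (κ sj.1) sj.2).natAbs).bddAbove
  refine ⟨K, fun ℓ ⟨s, hs, hpos⟩ j => ?_⟩
  have hmori : (κ ⟨s, hs⟩ + ℓ).1 ∈ moriPoints P T :=
    NonnegOffFacet.mem_moriPoints ⟨s, hs, fun v hv => by
      simpa only [Submodule.coe_add, Pi.add_apply, hκ ⟨s, hs⟩ v hv] using hpos v hv⟩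
      (Subtype.prop _)
  have hsum := hl _ hmori j
  have hbound : (l.repr (κ ⟨s, hs⟩) j).natAbs ≤ K := hK ⟨(⟨s, hs⟩, j), rfl⟩
  rw [map_add, Finsupp.add_apply] at hsum
  omega

end Relations

/-! ### The faces opposite to the origin lie on the boundary -/

section Boundary

variable {n : ℕ} {P : ReflexivePolytope n} {T : Geometry.SimplicialComplex ℝ (Fin n → ℝ)}
  {s t : Finset (Fin n → ℝ)} {p : Fin n → P.Pt} {w : Fin n → Fin n → ℤ} {c : Fin n → ℝ}

theorem sum_smul_toReal_dotProduct (hdual : ∀ i k, (p i).1 ⬝ᵥ w k = if i = k then 1 else 0)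
    (c : Fin n → ℝ) (k : Fin n) : (∑ i, c i • toReal (p i).1) ⬝ᵥ toReal (w k) = c k := by
  simp [sum_dotProduct, toReal_dotProduct, hdual]

variable (hT : IsRegularProjective P T) (hs : s ∈ T.facets)
  (hmem : ∀ v : P.Pt, toReal v.1 ∈ s ↔ v = P.origin ∨ ∃ k, v = p k)
  (hdual : ∀ i k, (p i).1 ⬝ᵥ w k = if i = k then 1 else 0)
include hT hs hmem hdual

theorem eq_of_sum_smul_mem_convexHull (ht : t ∈ T.facets) (hc : ∀ k, 0 < c k) (hc1 : ∑ k, c k = 1)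
    (hct : ∑ k, c k • toReal (p k).1 ∈ convexHull ℝ (t : Set (Fin n → ℝ))) : s = t := by
  have hps (k : Fin n) : toReal (p k).1 ∈ s := (hmem _).2 (Or.inr ⟨k, rfl⟩)
  have hcs : ∑ k, c k • toReal (p k).1 ∈ convexHull ℝ (s : Set (Fin n → ℝ)) :=
    (convex_convexHull ℝ _).sum_mem (fun k _ => (hc k).le) hc1
      fun k _ => subset_convexHull ℝ _ (hps k)
  have hcst := T.inter_subset_convexHull (T.facets_subset hs) (T.facets_subset ht) ⟨hcs, hct⟩
  refine hs.2 (T.facets_subset ht) fun x hx => ?_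
  obtain ⟨v, rfl⟩ := exists_pt_of_mem_facet hT hs hx
  rcases (hmem v).1 hx with rfl | ⟨k, rfl⟩
  · exact origin_mem_facet hT ht
  by_contra hkt
  have hle : (∑ i, c i • toReal (p i).1) ⬝ᵥ toReal (w k) ≤ 0 := by
    refine dotProduct_le_of_mem_convexHull (fun y hy => ?_) hcst
    obtain ⟨v, rfl⟩ := exists_pt_of_mem_facet hT hs hy.1
    rcases (hmem v).1 hy.1 with rfl | ⟨i, rfl⟩
    · simp [ReflexivePolytope.origin, toReal_zero]
    · have hik : i ≠ k := fun h => hkt (h ▸ hy.2)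
      simp [toReal_dotProduct, hdual, hik]
  rw [sum_smul_toReal_dotProduct hdual] at hle
  exact absurd (hc k) hle.not_gt

theorem sum_le_one_of_sum_smul_mem_carrier (hc : ∀ k, 0 < c k)
    (hcP : ∑ k, c k • toReal (p k).1 ∈ P.carrier) : ∑ k, c k ≤ 1 := by
  by_contra! hlt
  have hpos : 0 < ∑ k, c k := one_pos.trans hlt
  obtain ⟨t, ht, hct⟩ := exists_facet_of_mem_carrier hT hcP
  have hscaled : ∑ k, ((∑ k, c k)⁻¹ * c k) • toReal (p k).1 ∈
      convexHull ℝ (t : Set (Fin n → ℝ)) := by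
    simp only [mul_smul, ← Finset.smul_sum]
    refine (convex_convexHull ℝ _).smul_mem_of_zero_mem (subset_convexHull ℝ _ ?_) hct
      ⟨by positivity, inv_le_one_of_one_le₀ hlt.le⟩
    simpa [ReflexivePolytope.origin, toReal_zero] using origin_mem_facet hT ht
  obtain rfl := eq_of_sum_smul_mem_convexHull hT hs hmem hdual ht
    (fun k => mul_pos (inv_pos.2 hpos) (hc k))
    (by rw [← Finset.mul_sum, inv_mul_cancel₀ hpos.ne']) hscaled
  have hheight : (∑ k, c k • toReal (p k).1) ⬝ᵥ (∑ k, toReal (w k)) ≤ 1 := by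
    refine dotProduct_le_of_mem_convexHull (fun y hy => ?_) hct
    obtain ⟨v, rfl⟩ := exists_pt_of_mem_facet hT hs hy
    rcases (hmem v).1 hy with rfl | ⟨i, rfl⟩
    · simp [ReflexivePolytope.origin, toReal_zero]
    · simp [dotProduct_sum, toReal_dotProduct, hdual]
  simp only [dotProduct_sum, sum_smul_toReal_dotProduct hdual] at hheight
  exact hheight.not_gt hlt

theorem barycenter_notMem_interior (hn : 0 < n) :
    ∑ k, (n : ℝ)⁻¹ • toReal (p k).1 ∉ interior P.carrier := fun hc => by
  have hn0 : (0 : ℝ) < n := by exact_mod_cast hn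
  set c : Fin n → ℝ := ∑ k, (n : ℝ)⁻¹ • toReal (p k).1 with hc_def
  have hlim : Filter.Tendsto (fun μ : ℝ => μ • c) (nhdsWithin 1 (Set.Ioi 1)) (nhds c) := by
    have hcont : ContinuousAt (fun μ : ℝ => μ • c) 1 := by fun_prop
    simpa using hcont.tendsto.mono_left nhdsWithin_le_nhds
  obtain ⟨μ, hμP, hμ : 1 < μ⟩ := ((hlim.eventually_mem (mem_interior_iff_mem_nhds.1 hc)).and
    self_mem_nhdsWithin).exists
  simp only [hc_def, Finset.smul_sum, smul_smul] at hμP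
  have hle := sum_le_one_of_sum_smul_mem_carrier hT hs hmem hdual
    (fun _ => mul_pos (one_pos.trans hμ) (inv_pos.2 hn0)) hμP
  rw [Finset.sum_const, Finset.card_univ, Fintype.card_fin, nsmul_eq_mul, mul_left_comm,
    mul_inv_cancel₀ hn0.ne', mul_one] at hle
  exact hle.not_gt hμ

omit hs hmem hdual in
theorem exists_supporting_functional_of_facet (hs : s ∈ T.facets) : ∃ u : Fin n → ℝ,
    (∀ x ∈ P.carrier, -1 ≤ x ⬝ᵥ u) ∧
      ∀ v : P.Pt, toReal v.1 ∈ s → v ≠ P.origin → toReal v.1 ⬝ᵥ u = -1 := by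
  obtain ⟨p, w, hmem, hdual, -⟩ := exists_dual_bases_of_facet hT hs
  rcases Nat.eq_zero_or_pos n with rfl | hn
  · exact ⟨0, by simp, fun v _ hv0 => absurd (Subtype.ext (Subsingleton.elim _ _)) hv0⟩
  have hn0 : (0 : ℝ) < n := by exact_mod_cast hn
  obtain ⟨u, hu, hcu⟩ := exists_supporting_functional (convex_convexHull ℝ _)
    P.zero_mem_interior (barycenter_notMem_interior hT hs hmem hdual hn)
  refine ⟨u, hu, fun v hv hv0 => ?_⟩
  have hge (k : Fin n) : 0 ≤ (n : ℝ)⁻¹ * (toReal (p k).1 ⬝ᵥ u + 1) :=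
    mul_nonneg (inv_nonneg.2 hn0.le) (by linarith [hu _ (p k).2])
  have hsum : ∑ k, (n : ℝ)⁻¹ * (toReal (p k).1 ⬝ᵥ u + 1) = 0 := by
    simp only [sum_dotProduct, smul_dotProduct, smul_eq_mul] at hcu
    simp only [mul_add, Finset.sum_add_distrib, hcu, mul_one, Finset.sum_const, Finset.card_univ,
      Fintype.card_fin, nsmul_eq_mul, mul_inv_cancel₀ hn0.ne']
    norm_num
  obtain ⟨k, rfl⟩ := ((hmem v).1 hv).resolve_left hv0
  have hk := (Finset.sum_eq_zero_iff_of_nonneg fun k _ => hge k).1 hsum k (Finset.mem_univ k)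
  rcases mul_eq_zero.1 hk with h | h
  · exact absurd h (inv_ne_zero hn0.ne')
  · linarith

end Boundary

/-! ### The cohomology ring and the coefficients of the series -/

section Cohomology

variable {n : ℕ} {P : ReflexivePolytope n} {T : Geometry.SimplicialComplex ℝ (Fin n → ℝ)}

theorem sum_divisorClass : ∑ v, divisorClass P T v = 0 := by
  have h : Ideal.Quotient.mk (cohomologyIdeal P T) (∑ v : P.Pt, MvPolynomial.X v) = 0 :=
    Ideal.Quotient.eq_zero_iff_mem.2 (Ideal.subset_span (Or.inl (Or.inl rfl)))
  rw [map_sum] at h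
  exact h

theorem sum_smul_divisorClass (j : Fin n) :
    ∑ v : P.Pt, (v.1 j : ℂ) • divisorClass P T v = 0 := by
  have h : Ideal.Quotient.mk (cohomologyIdeal P T)
      (∑ v : P.Pt, MvPolynomial.C (v.1 j : ℂ) * MvPolynomial.X v) = 0 :=
    Ideal.Quotient.eq_zero_iff_mem.2 (Ideal.subset_span (Or.inl (Or.inr ⟨j, rfl⟩)))
  rw [map_sum] at h
  refine (Finset.sum_congr rfl fun v _ => ?_).trans h
  rw [map_mul, Algebra.smul_def]
  rfl

theorem sum_dotProduct_smul_divisorClass (w : Fin n → ℤ) :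
    ∑ v : P.Pt, ((v.1 ⬝ᵥ w : ℤ) : ℂ) • divisorClass P T v = 0 := by
  have h := sum_affine_smul_eq_zero (D := divisorClass P T) sum_divisorClass
    sum_smul_divisorClass 0 (fun j => (w j : ℂ))
  simpa [dotProduct, mul_comm] using h

open Classical in
theorem prod_divisorClass_eq_zero {S : Finset P.Pt} (hS : S.Nonempty) (h0 : P.origin ∉ S)
    (hS_faces : S.image (fun v => toReal v.1) ∉ T.faces) : ∏ v ∈ S, divisorClass P T v = 0 := by
  have h : Ideal.Quotient.mk (cohomologyIdeal P T) (∏ v ∈ S, MvPolynomial.X v) = 0 :=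
    Ideal.Quotient.eq_zero_iff_mem.2 (Ideal.subset_span (Or.inr ⟨S, hS, h0, hS_faces, rfl⟩))
  rw [map_prod] at h
  exact h

variable (hT : IsRegularProjective P T)
include hT

theorem exists_facet_of_prod_divisorClass_ne_zero {S : Finset P.Pt} (h0 : P.origin ∉ S)
    (h : ∏ v ∈ S, divisorClass P T v ≠ 0) : ∃ s ∈ T.facets, ∀ v ∈ S, toReal v.1 ∈ s := by
  classical
  rcases S.eq_empty_or_nonempty with rfl | hS
  · obtain ⟨s, hs, -⟩ := exists_facet_of_mem_carrier hT P.origin.2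
    exact ⟨s, hs, by simp⟩
  · by_cases hS_faces : S.image (fun v => toReal v.1) ∈ T.faces
    · obtain ⟨s, hs, hSs⟩ := exists_facet_superset hS_faces
      exact ⟨s, hs, fun v hv => hSs (Finset.mem_image_of_mem _ hv)⟩
    · exact absurd (prod_divisorClass_eq_zero hS h0 hS_faces) h

theorem divisorClass_mem_span_notMem_facet {s : Finset (Fin n → ℝ)} (hs : s ∈ T.facets)
    (v : P.Pt) :
    divisorClass P T v ∈ Ideal.span (divisorClass P T '' {x | toReal x.1 ∉ s}) := by
  set J := Ideal.span (divisorClass P T '' {x | toReal x.1 ∉ s})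
  obtain ⟨p, w, hmem, hdual, -⟩ := exists_dual_bases_of_facet hT hs
  have hmem_of_notMem (x : P.Pt) (hx : toReal x.1 ∉ s) : divisorClass P T x ∈ J :=
    Ideal.subset_span ⟨x, hx, rfl⟩
  have hmem_of_basis (k : Fin n) : divisorClass P T (p k) ∈ J := by
    have hlin := sum_dotProduct_smul_divisorClass (P := P) (T := T) (w k)
    rw [← Finset.add_sum_erase _ _ (Finset.mem_univ (p k)), hdual, if_pos rfl, Int.cast_one,
      one_smul] at hlin
    rw [eq_neg_of_add_eq_zero_left hlin]
    refine J.neg_mem (J.sum_mem fun x hx => ?_)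
    by_cases hxs : toReal x.1 ∈ s
    · rcases (hmem x).1 hxs with rfl | ⟨i, rfl⟩
      · simp [ReflexivePolytope.origin]
      · have hik : i ≠ k := fun h => Finset.ne_of_mem_erase hx (h ▸ rfl)
        simp [hdual, hik]
    · rw [Algebra.smul_def]
      exact J.mul_mem_left _ (hmem_of_notMem x hxs)
  have hmem_of_ne (x : P.Pt) (hx : x ≠ P.origin) : divisorClass P T x ∈ J := by
    by_cases hxs : toReal x.1 ∈ s
    · obtain ⟨k, rfl⟩ := ((hmem x).1 hxs).resolve_left hx
      exact hmem_of_basis k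
    · exact hmem_of_notMem x hxs
  by_cases hv : v = P.origin
  · have hsum := sum_divisorClass (P := P) (T := T)
    rw [← Finset.add_sum_erase _ _ (Finset.mem_univ P.origin)] at hsum
    rw [hv, eq_neg_of_add_eq_zero_left hsum]
    exact J.neg_mem (J.sum_mem fun x hx => hmem_of_ne x (Finset.ne_of_mem_erase hx))
  · exact hmem_of_ne v hv

theorem isNilpotent_divisorClass (v : P.Pt) : IsNilpotent (divisorClass P T v) := by
  classical
  rw [nilpotent_iff_mem_prime]
  intro J hJ
  set S : Finset P.Pt := {x | x ≠ P.origin ∧ divisorClass P T x ∉ J} with hS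
  have hprod : ∏ x ∈ S, divisorClass P T x ∉ J := fun h => by
    obtain ⟨x, hx, hxJ⟩ := hJ.prod_mem_iff.1 h
    exact (Finset.mem_filter.1 hx).2.2 hxJ
  obtain ⟨s, hs, hSs⟩ := exists_facet_of_prod_divisorClass_ne_zero hT (S := S) (by simp [hS])
    fun h => hprod (h ▸ J.zero_mem)
  refine Ideal.span_le.2 ?_ (divisorClass_mem_span_notMem_facet hT hs v)
  rintro _ ⟨x, hxs : toReal x.1 ∉ s, rfl⟩
  by_contra hxJ
  have hx0 : x ≠ P.origin := fun h => hxs (h ▸ origin_mem_facet hT hs)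
  exact hxs (hSs x (Finset.mem_filter.2 ⟨Finset.mem_univ x, hx0, hxJ⟩))

theorem isUnit_divisorClass_add_natCast_succ (v : P.Pt) (k : ℕ) :
    IsUnit (divisorClass P T v + ((k + 1 : ℕ) : Cohomology P T)) :=
  isUnit_add_natCast_succ_of_isNilpotent (isNilpotent_divisorClass hT v) k

theorem finite_cohomology : Module.Finite ℂ (Cohomology P T) := by
  have hadjoin : Algebra.adjoin ℂ (Set.range (divisorClass P T)) = ⊤ := by
    have hX := congrArg (Subalgebra.map (Ideal.Quotient.mkₐ ℂ (cohomologyIdeal P T)))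
      (MvPolynomial.adjoin_range_X (σ := P.Pt) (R := ℂ))
    rw [AlgHom.map_adjoin, Algebra.map_top,
      (AlgHom.range_eq_top _).2 (Ideal.Quotient.mkₐ_surjective _ _), ← Set.range_comp] at hX
    exact hX
  have hfinite := Algebra.finite_adjoin_of_finite_of_isIntegral (R := ℂ)
    (s := Set.range (divisorClass P T)) (Set.finite_range _) (by
      rintro _ ⟨v, rfl⟩
      obtain ⟨N, hN⟩ := isNilpotent_divisorClass hT v
      refine IsIntegral.of_pow N.succ_pos ?_
      rw [pow_succ, hN, zero_mul]
      exact isIntegral_zero)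
  rw [hadjoin] at hfinite
  exact Module.Finite.equiv (Subalgebra.topEquiv (R := ℂ) (A := Cohomology P T)).toLinearEquiv

end Cohomology

section Coefficients

variable {n : ℕ} {P : ReflexivePolytope n} {T : Geometry.SimplicialComplex ℝ (Fin n → ℝ)}

theorem oCoeff_eq_gammaCoeff {ℓ : P.Pt → ℤ} (h0 : ℓ P.origin ≤ 0) :
    oCoeff P T ℓ = gammaCoeff (Function.update (divisorClass P T) P.origin
      (divisorClass P T P.origin - 1)) ℓ := by
  have horigin : Finset.univ.filter (fun v : P.Pt => ¬ v ≠ P.origin) = {P.origin} := by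
    ext v
    simp
  rw [gammaCoeff, ← Finset.prod_filter_mul_prod_filter_not (M := Cohomology P T) Finset.univ
    (· ≠ P.origin), horigin,
    ← Finset.prod_filter_mul_prod_filter_not (M := Cohomology P T) _ (ℓ · < 0),
    Finset.filter_filter, Finset.filter_filter, Finset.prod_singleton, Function.update_self,
    gammaQuot_of_nonpos _ h0, oCoeff, ← MonoidWithZero.coe_inverse, map_prod]
  simp only [not_lt]
  refine congrArg₂ _ (congrArg₂ _ ?_ ?_) ?_
  · refine Finset.prod_congr rfl fun v hv => ?_
    obtain ⟨-, hv0, hneg⟩ := Finset.mem_filter.1 hv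
    rw [Function.update_of_ne hv0, gammaQuot_of_nonpos _ hneg.le]
  · refine Finset.prod_congr rfl fun v hv => ?_
    obtain ⟨-, hv0, hnonneg⟩ := Finset.mem_filter.1 hv
    rw [Function.update_of_ne hv0, gammaQuot_of_nonneg _ hnonneg, MonoidWithZero.coe_inverse]
  · refine Finset.prod_congr rfl fun k _ => ?_
    push_cast
    ring

variable (hT : IsRegularProjective P T)
include hT

theorem NonnegOffFacet.apply_origin_nonpos {ℓ : P.Pt → ℤ} (h : NonnegOffFacet T ℓ)
    (hℓ : ℓ ∈ relationLattice P) : ℓ P.origin ≤ 0 := by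
  obtain ⟨s, hs, hpos⟩ := h
  obtain ⟨u, hu, hus⟩ := exists_supporting_functional_of_facet hT hs
  have hsum : ∑ v, (ℓ v : ℝ) * (1 + u ⬝ᵥ toReal v.1) = 0 := sum_mul_affine_eq_zero hℓ 1 u
  rw [← Finset.add_sum_erase _ _ (Finset.mem_univ P.origin)] at hsum
  have hrest : 0 ≤ ∑ v ∈ Finset.univ.erase P.origin, (ℓ v : ℝ) * (1 + u ⬝ᵥ toReal v.1) := by
    refine Finset.sum_nonneg fun v hv => ?_
    rw [dotProduct_comm]
    by_cases hvs : toReal v.1 ∈ s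
    · simp [hus v hvs (Finset.ne_of_mem_erase hv)]
    · exact mul_nonneg (by exact_mod_cast hpos v hvs) (by linarith [hu _ v.2])
  have horigin : u ⬝ᵥ toReal P.origin.1 = 0 := by
    simp [ReflexivePolytope.origin, toReal_zero]
  rw [horigin, add_zero, mul_one] at hsum
  have hle : (ℓ P.origin : ℝ) ≤ 0 := by linarith
  exact_mod_cast hle

theorem nonnegOffFacet_of_prod_divisorClass_dvd {m : P.Pt → ℤ} {x : Cohomology P T} (hx : x ≠ 0)
    (hdvd : ∏ v : P.Pt with v ≠ P.origin ∧ m v < 0, divisorClass P T v ∣ x) :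
    NonnegOffFacet T m := by
  obtain ⟨s, hs, hsub⟩ := exists_facet_of_prod_divisorClass_ne_zero hT (by simp)
    fun h0 => hx (zero_dvd_iff.1 (h0 ▸ hdvd))
  refine ⟨s, hs, fun v hv => ?_⟩
  by_contra! hneg
  have hv0 : v ≠ P.origin := fun h => hv (h ▸ origin_mem_facet hT hs)
  exact hv (hsub v (Finset.mem_filter.2 ⟨Finset.mem_univ v, hv0, hneg⟩))

theorem nonnegOffFacet_of_gammaCoeff_ne_zero {m : P.Pt → ℤ}
    (h : gammaCoeff (divisorClass P T) m ≠ 0) : NonnegOffFacet T m :=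
  nonnegOffFacet_of_prod_divisorClass_dvd hT h
    (prod_dvd_gammaCoeff _ fun _ hv => (Finset.mem_filter.1 hv).2.2)

theorem nonnegOffFacet_of_oCoeff_ne_zero {ℓ : P.Pt → ℤ} (h : oCoeff P T ℓ ≠ 0) :
    NonnegOffFacet T ℓ := by
  refine nonnegOffFacet_of_prod_divisorClass_dvd hT h (Dvd.dvd.mul_right (Dvd.dvd.mul_right
    (Finset.prod_dvd_prod_of_dvd _ _ fun v hv => ?_) _) _)
  have hneg : 0 < (-ℓ v).toNat := by
    have := (Finset.mem_filter.1 hv).2.2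
    omega
  simpa using Finset.dvd_prod_of_mem (fun k : ℕ => divisorClass P T v - (k : Cohomology P T))
    (Finset.mem_range.2 hneg)

theorem oCoeff_eq_zero_of_notMem_moriPoints {ℓ : P.Pt → ℤ} (hℓ : ℓ ∈ relationLattice P)
    (hM : ℓ ∉ moriPoints P T) : oCoeff P T ℓ = 0 := by
  by_contra h
  exact hM ((nonnegOffFacet_of_oCoeff_ne_zero hT h).mem_moriPoints hℓ)

theorem oCoeff_mul_divisorClass_origin {ℓ : P.Pt → ℤ} (hℓ : ℓ ∈ relationLattice P) :
    oCoeff P T ℓ * divisorClass P T P.origin =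
      gammaCoeff (divisorClass P T) (-Pi.single P.origin 1 + ℓ) := by
  rw [neg_add_eq_sub]
  by_cases h0 : ℓ P.origin ≤ 0
  · rw [oCoeff_eq_gammaCoeff h0, mul_comm, gammaCoeff_sub_single_of_nonpos _ h0]
  have hnot : ¬ NonnegOffFacet T ℓ := fun h => h0 (h.apply_origin_nonpos hT hℓ)
  have hO : oCoeff P T ℓ = 0 := by
    by_contra h
    exact hnot (nonnegOffFacet_of_oCoeff_ne_zero hT h)
  have hgamma : gammaCoeff (divisorClass P T) (ℓ - Pi.single P.origin 1) = 0 := by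
    by_contra h
    refine hnot ((nonnegOffFacet_of_gammaCoeff_ne_zero hT h).congr hT fun v hv => ?_)
    rw [Pi.sub_apply, Pi.single_eq_of_ne hv, sub_zero]
  rw [hO, zero_mul, hgamma]

end Coefficients

/-! ### Convergence and transfer to a Banach algebra -/

section Transfer

theorem nilpotentExp_eq_exp {A : Type*} [CommRing A] [Algebra ℚ A] [TopologicalSpace A]
    [IsTopologicalRing A] {x : A} (hx : IsNilpotent x) :
    IsNilpotent.exp x = NormedSpace.exp x := by
  obtain ⟨N, hN⟩ := hx
  rw [IsNilpotent.exp_eq_sum hN, NormedSpace.exp_eq_tsum ℚ]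
  refine (tsum_eq_sum fun k hk => ?_).symm
  rw [pow_eq_zero_of_le (by simpa using hk) hN, smul_zero]

theorem exists_normedAlgebra (H : Type) [CommRing H] [Algebra ℂ H] [Module.Finite ℂ H] :
    ∃ (R : Type) (_ : NormedCommRing R) (_ : NormedAlgebra ℂ R), Nonempty (H ≃ₐ[ℂ] R) := by
  classical
  let mulMatrix := Algebra.leftMulMatrix (Module.finBasis ℂ H)
  let : NormedRing (Matrix (Fin (Module.finrank ℂ H)) (Fin (Module.finrank ℂ H)) ℂ) :=
    Matrix.linftyOpNormedRing
  let : NormedAlgebra ℂ (Matrix (Fin (Module.finrank ℂ H)) (Fin (Module.finrank ℂ H)) ℂ) :=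
    Matrix.linftyOpNormedAlgebra
  let normedCommRing : NormedCommRing H :=
    NormedCommRing.induced H _ mulMatrix (Algebra.leftMulMatrix_injective _)
  exact ⟨H, normedCommRing, NormedAlgebra.induced ℂ H _ mulMatrix, ⟨AlgEquiv.refl⟩⟩

end Transfer

section Domination

variable {n : ℕ} {P : ReflexivePolytope n} {T : Geometry.SimplicialComplex ℝ (Fin n → ℝ)}
  {r : ℕ} {l : Module.Basis (Fin r) ℤ (relationLattice P)}
  {R : Type*} [NormedCommRing R] [NormedAlgebra ℂ R] [CompleteSpace R]

theorem exists_growth_gammaCoeff (D : P.Pt → R) :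
    ∃ Q : ℝ, 1 ≤ Q ∧ ∀ γ : P.Pt → ℤ, ∃ C : ℝ, ∀ ℓ : relationLattice P,
      ‖gammaCoeff D (γ + ℓ.1)‖ ≤ C * Q ^ oneNorm ℓ.1 := by
  obtain ⟨Q, hQ, hbound⟩ := exists_norm_gammaCoeff_le D
  refine ⟨Q, hQ, fun γ => ?_⟩
  obtain ⟨C, hC⟩ := hbound (∑ v, γ v)
  refine ⟨|C| * Q ^ oneNorm γ, fun ℓ => (hC (γ + ℓ.1) ?_).trans ?_⟩
  · simp only [Pi.add_apply, Finset.sum_add_distrib, (mem_relationLattice_iff.1 ℓ.2).2, add_zero]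
  · rw [mul_assoc, ← pow_add]
    gcongr
    · exact le_abs_self C
    · exact oneNorm_add_le _ _

variable (hT : IsRegularProjective P T)
  (hl : ∀ ℓ : relationLattice P, ℓ.1 ∈ moriPoints P T → ∀ j, 0 ≤ l.repr ℓ j)
  (φ : Cohomology P T ≃ₐ[ℂ] R)
include hT hl

theorem exists_isDominated_gammaCoeff : ∃ Q : ℝ, 1 ≤ Q ∧ ∀ γ : P.Pt → ℤ,
    IsDominated l Q fun ℓ => gammaCoeff (φ ∘ divisorClass P T) (γ + ℓ.1) := by
  obtain ⟨Q, hQ, hgrowth⟩ := exists_growth_gammaCoeff (φ ∘ divisorClass P T)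
  refine ⟨Q, hQ, fun γ => ⟨hgrowth γ, ?_⟩⟩
  obtain ⟨K, hK⟩ := exists_le_repr_of_nonnegOffFacet hT hl γ
  refine ⟨K, fun ℓ hℓ => hK ℓ (nonnegOffFacet_of_gammaCoeff_ne_zero hT fun h0 => hℓ ?_)⟩
  have hmap := map_gammaCoeff φ.toRingEquiv (divisorClass P T) (γ + ℓ.1)
  rw [h0, map_zero] at hmap
  exact hmap.symm

theorem exists_isDominated_oCoeff : ∃ Q : ℝ, 1 ≤ Q ∧
    IsDominated l Q fun ℓ => φ (oCoeff P T ℓ.1) := by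
  set D := Function.update (divisorClass P T) P.origin (divisorClass P T P.origin - 1)
  obtain ⟨Q, hQ, hgrowth⟩ := exists_growth_gammaCoeff (φ ∘ D)
  obtain ⟨C, hC⟩ := hgrowth 0
  refine ⟨Q, hQ, ⟨C, fun ℓ => ?_⟩, 0, fun ℓ hℓ => ?_⟩
  · have hbound := hC ℓ
    by_cases h0 : ℓ.1 P.origin ≤ 0
    · rw [zero_add] at hbound
      rwa [oCoeff_eq_gammaCoeff h0, ← AlgEquiv.coe_ringEquiv, map_gammaCoeff]
    · have hO : oCoeff P T ℓ.1 = 0 := by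
        by_contra h
        exact h0 ((nonnegOffFacet_of_oCoeff_ne_zero hT h).apply_origin_nonpos hT ℓ.2)
      rw [hO, map_zero, norm_zero]
      exact (norm_nonneg _).trans hbound
  · have hM : ℓ.1 ∈ moriPoints P T := by
      by_contra h
      rw [oCoeff_eq_zero_of_notMem_moriPoints hT ℓ.2 h, map_zero] at hℓ
      exact hℓ rfl
    simpa using hl ℓ hM

theorem exists_isDominated : ∃ Q : ℝ, 1 ≤ Q ∧
    (∀ γ : P.Pt → ℤ, IsDominated l Q fun ℓ => gammaCoeff (φ ∘ divisorClass P T) (γ + ℓ.1)) ∧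
    IsDominated l Q fun ℓ => φ (oCoeff P T ℓ.1) := by
  obtain ⟨Q₁, hQ₁, hgamma⟩ := exists_isDominated_gammaCoeff hT hl φ
  obtain ⟨Q₂, hQ₂, hO⟩ := exists_isDominated_oCoeff hT hl φ
  exact ⟨max Q₁ Q₂, hQ₁.trans (le_max_left _ _), fun γ => (hgamma γ).mono hQ₁ (le_max_left _ _),
    hO.mono hQ₂ (le_max_right _ _)⟩

end Domination

section BFunction

variable {n : ℕ} {P : ReflexivePolytope n} {T : Geometry.SimplicialComplex ℝ (Fin n → ℝ)}
  {R : Type*} [NormedCommRing R] [NormedAlgebra ℂ R]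

instance isModuleTopology_cohomology : IsModuleTopology ℂ (Cohomology P T) := ⟨rfl⟩

theorem continuous_algEquiv_cohomology (φ : Cohomology P T ≃ₐ[ℂ] R) : Continuous φ :=
  have := IsModuleTopology.toContinuousSMul ℂ (Cohomology P T)
  IsModuleTopology.continuous_of_linearMap φ.toLinearMap

theorem continuous_algEquiv_cohomology_symm [Module.Finite ℂ R] (φ : Cohomology P T ≃ₐ[ℂ] R) :
    Continuous φ.symm :=
  have := IsModuleTopology.toContinuousSMul ℂ (Cohomology P T)
  have := IsModuleTopology.topologicalAddGroup ℂ (Cohomology P T)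
  LinearMap.continuous_of_finiteDimensional φ.symm.toLinearMap

variable [CompleteSpace R] {r : ℕ} {l : Module.Basis (Fin r) ℤ (relationLattice P)}
  {Q : ℝ} (hQ : 1 ≤ Q) (hT : IsRegularProjective P T) (φ : Cohomology P T ≃ₐ[ℂ] R)
  (hO : IsDominated l Q fun ℓ => φ (oCoeff P T ℓ.1)) {a : P.Pt → ℂ}
  (ha : a ∈ lcslNhd P l (convRadius l Q))
include hT hO hQ ha

theorem hasSum_smul_oCoeff [Module.Finite ℂ R] :
    HasSum (fun ℓ : moriPoints P T => laurent ℓ.1 a • oCoeff P T ℓ.1)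
      (φ.symm (laurentSeries (fun ℓ => φ (oCoeff P T ℓ.1)) 0 a)) := by
  let incl (ℓ : moriPoints P T) : relationLattice P := ⟨ℓ.1, ℓ.2.1⟩
  have hincl : Function.Injective incl := fun x y h => Subtype.ext (congrArg (·.1) h)
  have hsupp : ∀ ℓ ∉ Set.range incl, laurent (0 + ℓ.1) a • φ (oCoeff P T ℓ.1) = 0 := by
    intro ℓ hℓ
    rw [oCoeff_eq_zero_of_notMem_moriPoints hT ℓ.2 fun hM => hℓ ⟨⟨ℓ.1, hM⟩, rfl⟩, map_zero,
      smul_zero]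
  have hsum := ((hincl.hasSum_iff hsupp).2 (hO.summable_laurentSeries hQ 0 ha).hasSum).map φ.symm
    (continuous_algEquiv_cohomology_symm φ)
  refine hsum.congr_fun fun ℓ => ?_
  simp only [Function.comp_apply, map_smul, AlgEquiv.symm_apply_apply, zero_add, incl]

theorem inv_smul_laurentSeries_mul_origin :
    (a P.origin)⁻¹ • (laurentSeries (fun ℓ => φ (oCoeff P T ℓ.1)) 0 a *
      φ (divisorClass P T P.origin)) =
      gammaSeries (φ ∘ divisorClass P T) (-Pi.single P.origin 1) a := by
  refine ((((hO.summable_laurentSeries hQ 0 ha).hasSum.mul_right _).const_smul _).congr_fun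
    fun ℓ => ?_).tsum_eq.symm
  have hcoeff : gammaCoeff (φ ∘ divisorClass P T) (-Pi.single P.origin 1 + ℓ.1) =
      φ (oCoeff P T ℓ.1) * φ (divisorClass P T P.origin) := by
    rw [← map_mul, oCoeff_mul_divisorClass_origin hT ℓ.2]
    exact (map_gammaCoeff φ.toRingEquiv _ _).symm
  dsimp only
  rw [hcoeff, neg_add_eq_sub, zero_add, ← mul_laurent_sub_single ha.1 ℓ.1 P.origin,
    smul_mul_assoc, smul_smul, inv_mul_cancel_left₀ (ha.1 _)]

theorem map_bFunction_mul_divisorClass_origin [Module.Finite ℂ R] (lg : (P.Pt → ℂ) → P.Pt → ℂ) :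
    φ (bFunction P T lg a * divisorClass P T P.origin) =
      hyperSeries (φ ∘ divisorClass P T) lg (-Pi.single P.origin 1) a := by
  have : T2Space (Cohomology P T) :=
    .of_injective_continuous φ.injective (continuous_algEquiv_cohomology φ)
  let : Algebra ℚ R := Algebra.compHom R (algebraMap ℚ ℂ)
  have hnil : IsNilpotent (∑ v, lg a v • divisorClass P T v) :=
    isNilpotent_sum fun v _ => (isNilpotent_divisorClass hT v).smul _
  have hexp : φ (IsNilpotent.exp (∑ v, lg a v • divisorClass P T v)) =
      NormedSpace.exp (∑ v, lg a v • (φ ∘ divisorClass P T) v) := by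
    rw [IsNilpotent.map_exp hnil, nilpotentExp_eq_exp (hnil.map φ), map_sum]
    simp only [map_smul, Function.comp_apply]
  rw [hyperSeries, ← inv_smul_laurentSeries_mul_origin hQ hT φ hO ha, ← hexp, bFunction,
    (hasSum_smul_oCoeff hQ hT φ hO ha).tsum_eq, map_mul, map_smul, map_mul,
    AlgEquiv.apply_symm_apply, smul_mul_assoc, smul_mul_assoc, mul_right_comm]

end BFunction

/-! ### Facets and roots of a reflexive polytope -/

section PolarDual

variable {n : ℕ}

theorem convex_polarDual (S : Set (Fin n → ℝ)) : Convex ℝ (polarDual S) := by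
  simp only [polarDual, Set.ofPred_forall]
  exact convex_iInter₂ fun v _ => convex_halfSpace_ge ⟨dotProduct_add v, fun c =>
    dotProduct_smul c v⟩ (-1)

theorem isClosed_polarDual (S : Set (Fin n → ℝ)) : IsClosed (polarDual S) := by
  simp only [polarDual, Set.ofPred_forall]
  exact isClosed_biInter fun v _ => isClosed_le continuous_const (by fun_prop)

theorem isCompact_polarDual {S : Set (Fin n → ℝ)} (hS : S ∈ nhds 0) :
    IsCompact (polarDual S) := by
  obtain ⟨δ, hδ, hball⟩ := Metric.nhds_basis_closedBall.mem_iff.1 hS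
  refine Metric.isCompact_of_isClosed_isBounded (isClosed_polarDual S)
    (isBounded_iff_forall_norm_le.2 ⟨δ⁻¹, fun u hu => ?_⟩)
  refine (pi_norm_le_iff_of_nonneg (by positivity)).2 fun k => ?_
  have hcoord (c : ℝ) (hc : |c| = δ) : -1 ≤ c * u k := by
    simpa using hu (Pi.single k c) (hball (by simp [Pi.norm_single, hc]))
  have hpos := hcoord δ (abs_of_pos hδ)
  have hneg := hcoord (-δ) (by rw [abs_neg, abs_of_pos hδ])
  rw [Real.norm_eq_abs, ← one_div, abs_le, le_div_iff₀ hδ, ← neg_div, div_le_iff₀ hδ]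
  exact ⟨by linarith, by linarith⟩

theorem le_dotProduct_of_forall_extremePoints {S : Set (Fin n → ℝ)} (hS : S ∈ nhds 0)
    {x : Fin n → ℝ} {c : ℝ} (h : ∀ u ∈ (polarDual S).extremePoints ℝ, c ≤ x ⬝ᵥ u)
    {u : Fin n → ℝ} (hu : u ∈ polarDual S) : c ≤ x ⬝ᵥ u := by
  rw [← closure_convexHull_extremePoints (isCompact_polarDual hS) (convex_polarDual S)] at hu
  refine closure_minimal (convexHull_min (t := {u | c ≤ x ⬝ᵥ u}) h ?_) ?_ hu
  · exact convex_halfSpace_ge ⟨dotProduct_add x, fun c => dotProduct_smul c x⟩ c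
  · exact isClosed_le continuous_const (by fun_prop)

theorem mem_of_forall_polarDual {C : Set (Fin n → ℝ)} (hC : Convex ℝ C) (hclosed : IsClosed C)
    (h0 : 0 ∈ C) {x : Fin n → ℝ} (hx : ∀ u ∈ polarDual C, -1 ≤ x ⬝ᵥ u) : x ∈ C := by
  by_contra hxC
  obtain ⟨f, c, hfx, hf⟩ := geometric_hahn_banach_point_closed hC hclosed hxC
  have hc : c < 0 := by simpa using hf 0 h0
  have hdot (y : Fin n → ℝ) : (y ⬝ᵥ (-c)⁻¹ • fun j => f (Pi.single j 1)) = f y / -c := by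
    have hfy : f y = y ⬝ᵥ fun j => f (Pi.single j 1) := linearMap_eq_dotProduct f.toLinearMap y
    rw [dotProduct_smul, ← hfy, smul_eq_mul, inv_mul_eq_div]
  have hlt : x ⬝ᵥ ((-c)⁻¹ • fun j => f (Pi.single j 1)) < -1 := by
    rw [hdot, div_lt_iff₀ (neg_pos.2 hc)]
    linarith
  refine hlt.not_ge (hx _ fun y hy => ?_)
  rw [hdot, le_div_iff₀ (neg_pos.2 hc)]
  linarith [hf y hy]

theorem dotProduct_eq_of_mem_intrinsicInterior {F : Set (Fin n → ℝ)} {x y w : Fin n → ℝ} {c : ℝ}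
    (hF : ∀ y ∈ F, c ≤ y ⬝ᵥ w) (hx : x ∈ intrinsicInterior ℝ F) (hxc : x ⬝ᵥ w = c) (hy : y ∈ F) :
    y ⬝ᵥ w = c := by
  obtain ⟨x, hxF, rfl⟩ := mem_intrinsicInterior.1 hx
  let line (t : ℝ) : affineSpan ℝ F :=
    ⟨AffineMap.lineMap y (x : Fin n → ℝ) t, AffineMap.lineMap_mem t (subset_affineSpan ℝ F hy) x.2⟩
  have hline : Filter.Tendsto line (nhds 1) (nhds x) := by
    have hcont : Continuous line :=
      Continuous.subtype_mk AffineMap.lineMap_continuous _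
    have h1 : line 1 = x := Subtype.ext (AffineMap.lineMap_apply_one _ _)
    exact h1 ▸ hcont.tendsto 1
  obtain ⟨t, htF, ht : 1 < t⟩ := (((hline.mono_left nhdsWithin_le_nhds).eventually_mem
    (mem_interior_iff_mem_nhds.1 hxF)).and (self_mem_nhdsWithin (s := Set.Ioi 1))).exists
  have hle : c ≤ AffineMap.lineMap y (x : Fin n → ℝ) t ⬝ᵥ w := hF _ htF
  rw [AffineMap.lineMap_apply_module, add_dotProduct, smul_dotProduct, smul_dotProduct, hxc,
    smul_eq_mul, smul_eq_mul] at hle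
  exact le_antisymm (by nlinarith) (hF y hy)

end PolarDual

section Facets

variable {n : ℕ} {P : ReflexivePolytope n} {u : Fin n → ℝ}

theorem isClosed_carrier : IsClosed P.carrier :=
  (P.verts.finite_toSet.image toReal).isClosed_convexHull ℝ

theorem carrier_mem_nhds : P.carrier ∈ nhds 0 := mem_interior_iff_mem_nhds.1 P.zero_mem_interior

theorem mem_polarDual_carrier_iff :
    u ∈ polarDual P.carrier ↔ ∀ w ∈ P.verts, -1 ≤ toReal w ⬝ᵥ u := by
  refine ⟨fun hu w hw => hu _ (subset_convexHull ℝ _ ⟨w, hw, rfl⟩), fun h v hv => ?_⟩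
  have hle : v ⬝ᵥ -u ≤ 1 := dotProduct_le_of_mem_convexHull (by
    rintro _ ⟨w, hw, rfl⟩
    rw [dotProduct_neg]
    linarith [h w hw]) hv
  rw [dotProduct_neg] at hle
  linarith

theorem mem_carrier_iff {x : Fin n → ℝ} :
    x ∈ P.carrier ↔ ∀ u ∈ (polarDual P.carrier).extremePoints ℝ, -1 ≤ x ⬝ᵥ u :=
  ⟨fun hx _ hu => hu.1 x hx, fun h => mem_of_forall_polarDual (convex_convexHull ℝ _)
    isClosed_carrier (interior_subset P.zero_mem_interior) fun _ hu =>
    le_dotProduct_of_forall_extremePoints carrier_mem_nhds h hu⟩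

theorem eq_of_forall_verts (hu : u ∈ (polarDual P.carrier).extremePoints ℝ) {u' : Fin n → ℝ}
    (hu' : u' ∈ polarDual P.carrier)
    (h : ∀ w ∈ P.verts, toReal w ⬝ᵥ u = -1 → toReal w ⬝ᵥ u' = -1) : u' = u := by
  have hnear : ∀ᶠ t : ℝ in nhdsWithin 0 (Set.Ioi 0), u + t • (u - u') ∈ polarDual P.carrier := by
    simp only [mem_polarDual_carrier_iff, Filter.eventually_all_finset]
    intro w hw
    by_cases hwu : toReal w ⬝ᵥ u = -1
    · simp [dotProduct_add, dotProduct_sub, hwu, h w hw hwu]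
    · have hlt := lt_of_le_of_ne (mem_polarDual_carrier_iff.1 hu.1 w hw) (Ne.symm hwu)
      have hcont : ContinuousAt (fun t : ℝ => toReal w ⬝ᵥ (u + t • (u - u'))) 0 := by fun_prop
      exact (hcont.eventually_const_lt (by simpa using hlt)).filter_mono nhdsWithin_le_nhds |>.mono
        fun _ => le_of_lt
  obtain ⟨t, hmem, ht : 0 < t⟩ := (hnear.and self_mem_nhdsWithin).exists
  refine (mem_extremePoints.1 hu).2 u' hu' _ hmem ⟨t / (1 + t), 1 / (1 + t), by positivity,
    by positivity, by field_simp; ring, ?_⟩ |>.1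
  ext k
  simp only [Pi.add_apply, Pi.smul_apply, Pi.sub_apply, smul_eq_mul]
  field_simp
  ring

theorem finite_extremePoints_polarDual : ((polarDual P.carrier).extremePoints ℝ).Finite := by
  classical
  refine Set.Finite.of_injOn (f := fun u => P.verts.filter fun w => toReal w ⬝ᵥ u = -1)
    (t := P.verts.powerset) (fun u _ => Finset.mem_coe.2 (Finset.mem_powerset.2
      (Finset.filter_subset _ _))) (fun u hu u' hu' h => ?_) (Finset.finite_toSet _)
  exact (eq_of_forall_verts hu hu'.1 fun w hw => (Finset.filter_inj'.1 h hw).1).symm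

theorem mem_intrinsicInterior_facet_iff (hu : u ∈ (polarDual P.carrier).extremePoints ℝ)
    {x : Fin n → ℝ} :
    x ∈ intrinsicInterior ℝ {x | x ∈ P.carrier ∧ x ⬝ᵥ u = -1} ↔
      x ⬝ᵥ u = -1 ∧ ∀ u' ∈ (polarDual P.carrier).extremePoints ℝ, u' ≠ u → -1 < x ⬝ᵥ u' := by
  set F := {x | x ∈ P.carrier ∧ x ⬝ᵥ u = -1}
  constructor
  · intro hx
    obtain ⟨hxP, hxu⟩ : x ∈ F := intrinsicInterior_subset hx
    refine ⟨hxu, fun u' hu' hne => lt_of_le_of_ne (hu'.1 x hxP) fun hxu' => hne ?_⟩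
    refine eq_of_forall_verts hu hu'.1 fun w hw hwu => ?_
    exact dotProduct_eq_of_mem_intrinsicInterior (fun y hy => hu'.1 y hy.1) hx hxu'.symm
      ⟨subset_convexHull ℝ _ ⟨w, hw, rfl⟩, hwu⟩
  · rintro ⟨hxu, hx⟩
    have hmemF {y : Fin n → ℝ} (hyu : y ⬝ᵥ u = -1)
        (hy : ∀ u' ∈ (polarDual P.carrier).extremePoints ℝ, u' ≠ u → -1 < y ⬝ᵥ u') : y ∈ F := by
      refine ⟨mem_carrier_iff.2 fun u' hu' => ?_, hyu⟩
      obtain rfl | hne := eq_or_ne u' u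
      exacts [hyu.ge, (hy u' hu' hne).le]
    have hspan (y : affineSpan ℝ F) : (y : Fin n → ℝ) ⬝ᵥ u = -1 := by
      refine affineSpan_induction (p := fun y => y ⬝ᵥ u = -1) y.2 (fun z hz => hz.2) ?_
      intro c a b d ha hb hd
      rw [vsub_eq_sub, vadd_eq_add, add_dotProduct, smul_dotProduct, sub_dotProduct, ha, hb, hd,
        sub_self, smul_zero, zero_add]
    refine mem_intrinsicInterior.2 ⟨⟨x, subset_affineSpan ℝ F (hmemF hxu hx)⟩, ?_, rfl⟩
    refine mem_interior_iff_mem_nhds.2 (Filter.mem_of_superset ?_ fun y => hmemF (hspan y))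
    refine (finite_extremePoints_polarDual.eventually_all).2 fun u' hu' => ?_
    refine Filter.eventually_all.2 fun hne => ?_
    have hcont : Continuous fun y : affineSpan ℝ F => (y : Fin n → ℝ) ⬝ᵥ u' := by fun_prop
    exact hcont.continuousAt.eventually_const_lt (hx u' hu' hne)

end Facets

section Roots

variable {n : ℕ} {P : ReflexivePolytope n} {u v : Fin n → ℤ}

theorem toReal_mem_carrier_iff : toReal v ∈ P.carrier ↔
    ∀ u : Fin n → ℤ, toReal u ∈ (polarDual P.carrier).extremePoints ℝ → -1 ≤ v ⬝ᵥ u := by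
  rw [mem_carrier_iff]
  refine ⟨fun h u hu => by exact_mod_cast toReal_dotProduct v u ▸ h _ hu, fun h u hu => ?_⟩
  obtain ⟨u, rfl⟩ := P.dual_lattice u hu
  rw [toReal_dotProduct]
  exact_mod_cast h u hu

theorem isRoot_iff_dotProduct : IsRoot P u v ↔
    toReal u ∈ (polarDual P.carrier).extremePoints ℝ ∧ v ⬝ᵥ u = -1 ∧
      ∀ u' : Fin n → ℤ, toReal u' ∈ (polarDual P.carrier).extremePoints ℝ → u' ≠ u →
        0 ≤ v ⬝ᵥ u' := by
  refine and_congr_right fun hu => ?_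
  rw [mem_intrinsicInterior_facet_iff hu, toReal_dotProduct]
  refine and_congr (by norm_cast) ⟨fun h u' hu' hne => ?_, fun h u' hu' hne => ?_⟩
  · have hlt := h _ hu' (toReal_injective.ne hne)
    rw [toReal_dotProduct] at hlt
    have hlt : -1 < v ⬝ᵥ u' := by exact_mod_cast hlt
    omega
  · obtain ⟨u', rfl⟩ := P.dual_lattice u' hu'
    rw [toReal_dotProduct]
    have hle := h u' hu' (ne_of_apply_ne toReal hne)
    exact_mod_cast (show -1 < v ⬝ᵥ u' by omega)

theorem IsRoot.dotProduct_eq (h : IsRoot P u v) : v ⬝ᵥ u = -1 := (isRoot_iff_dotProduct.1 h).2.1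

theorem IsRoot.mem_carrier (h : IsRoot P u v) : toReal v ∈ P.carrier :=
  (intrinsicInterior_subset h.2).1

theorem IsRoot.add_mem_carrier (h : IsRoot P u v) {v' : Fin n → ℤ} (hv' : toReal v' ∈ P.carrier)
    (hne : v' ⬝ᵥ u ≠ -1) : toReal (v' + v) ∈ P.carrier := by
  obtain ⟨-, hvu, hv⟩ := isRoot_iff_dotProduct.1 h
  rw [toReal_mem_carrier_iff] at hv' ⊢
  intro u' hu'
  have hle := hv' u' hu'
  rw [add_dotProduct]
  obtain rfl | hne' := eq_or_ne u' u
  · omega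
  · have hnonneg := hv u' hu' hne'
    omega

theorem IsRoot.exists_add_eq (h : IsRoot P u v) :
    ∃ w : P.Pt → P.Pt, ∀ v' : P.Pt, v'.1 ⬝ᵥ u ≠ -1 → (w v').1 = v'.1 + v := by
  refine Classical.axiomOfChoice (r := fun v' w : P.Pt => v'.1 ⬝ᵥ u ≠ -1 → w.1 = v'.1 + v)
    fun v' => ?_
  by_cases hv' : v'.1 ⬝ᵥ u = -1
  · exact ⟨v', fun hne => absurd hv' hne⟩
  · exact ⟨⟨_, h.add_mem_carrier v'.2 hv'⟩, fun _ => rfl⟩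

end Roots

/-! ### The roots of projective space -/

section ProjectiveSpace

variable {n : ℕ}

theorem dotProduct_simplexNormal_zero (v : Fin n → ℤ) : v ⬝ᵥ simplexNormal 0 = -∑ k, v k := by
  simp [simplexNormal, dotProduct]

theorem dotProduct_simplexNormal_succ (v : Fin n → ℤ) (k : Fin n) :
    v ⬝ᵥ simplexNormal k.succ = v k := by
  simp [simplexNormal]

theorem sum_dotProduct_simplexNormal (v : Fin n → ℤ) : ∑ i, v ⬝ᵥ simplexNormal i = 0 := by
  rw [Fin.sum_univ_succ, dotProduct_simplexNormal_zero]
  simp only [dotProduct_simplexNormal_succ, neg_add_cancel]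

theorem eq_of_dotProduct_simplexNormal_eq {v w : Fin n → ℤ}
    (h : ∀ i, v ⬝ᵥ simplexNormal i = w ⬝ᵥ simplexNormal i) : v = w := by
  funext k
  simpa only [dotProduct_simplexNormal_succ] using h k.succ

theorem simplexPoint_dotProduct_simplexNormal (i k : Fin (n + 1)) :
    (simplexPoint i : Fin n → ℤ) ⬝ᵥ simplexNormal k =
      (if i = k then 1 else 0) - (if k = 0 then 1 else 0) := by
  cases k using Fin.cases with
  | zero =>
    rw [dotProduct_simplexNormal_zero]
    cases i using Fin.cases <;> simp [simplexPoint, Fin.succ_ne_zero]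
  | succ k =>
    rw [dotProduct_simplexNormal_succ]
    cases i using Fin.cases <;>
      simp [simplexPoint, Fin.succ_ne_zero, (Fin.succ_ne_zero k).symm, Pi.single_apply, eq_comm]

theorem simplexPoint_sub_dotProduct_simplexNormal (i j k : Fin (n + 1)) :
    (simplexPoint i - simplexPoint j : Fin n → ℤ) ⬝ᵥ simplexNormal k =
      (if i = k then 1 else 0) - (if j = k then 1 else 0) := by
  rw [sub_dotProduct, simplexPoint_dotProduct_simplexNormal,
    simplexPoint_dotProduct_simplexNormal, sub_sub_sub_cancel_right]

theorem simplexVertex_dotProduct_simplexNormal (i k : Fin (n + 1)) :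
    (simplexVertex i : Fin n → ℤ) ⬝ᵥ simplexNormal k = (n + 1) * (if i = k then 1 else 0) - 1 := by
  have hvertex : (simplexVertex i : Fin n → ℤ) = (n + 1 : ℤ) • simplexPoint i - 1 := by
    ext
    simp [simplexVertex]
  have hone : (1 : Fin n → ℤ) ⬝ᵥ simplexNormal k = 1 - (n + 1) * (if k = 0 then 1 else 0) := by
    cases k using Fin.cases <;>
      simp [dotProduct_simplexNormal_zero, dotProduct_simplexNormal_succ, Fin.succ_ne_zero]
  rw [hvertex, sub_dotProduct, smul_dotProduct, simplexPoint_dotProduct_simplexNormal, hone,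
    smul_eq_mul]
  ring

theorem simplexNormal_mem_polarDual (j : Fin (n + 1)) :
    toReal (simplexNormal j) ∈ polarDual (projectivePolytope n).carrier := by
  refine mem_polarDual_carrier_iff.2 fun w hw => ?_
  obtain ⟨i, -, rfl⟩ := Finset.mem_image.1 hw
  exact neg_one_le_simplexVertex_dot i j

theorem polarDual_projectivePolytope : polarDual (projectivePolytope n).carrier =
    convexHull ℝ (Set.range fun i : Fin (n + 1) => toReal (simplexNormal i : Fin n → ℤ)) := by
  refine Set.Subset.antisymm (fun u hu => mem_dualSimplex u fun i =>
    mem_polarDual_carrier_iff.1 hu _ (Finset.mem_image_of_mem _ (Finset.mem_univ i)))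
    (convexHull_min ?_ (convex_polarDual _))
  rintro _ ⟨j, rfl⟩
  exact simplexNormal_mem_polarDual j

theorem extremePoints_polarDual_projectivePolytope :
    (polarDual (projectivePolytope n).carrier).extremePoints ℝ =
      Set.range fun i : Fin (n + 1) => toReal (simplexNormal i : Fin n → ℤ) := by
  have hsub : (polarDual (projectivePolytope n).carrier).extremePoints ℝ ⊆
      Set.range fun i : Fin (n + 1) => toReal (simplexNormal i : Fin n → ℤ) :=
    polarDual_projectivePolytope (n := n) ▸ extremePoints_convexHull_subset
  refine hsub.antisymm ?_
  rintro _ ⟨j, rfl⟩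
  -- Otherwise the dual polytope would lie in the half-space `⟨simplexVertex j, ·⟩ ≤ -1`.
  by_contra hj
  have hle : 1 ≤ toReal (-simplexVertex j) ⬝ᵥ toReal (simplexNormal j : Fin n → ℤ) := by
    refine le_dotProduct_of_forall_extremePoints carrier_mem_nhds (fun u hu => ?_)
      (simplexNormal_mem_polarDual j)
    obtain ⟨i, rfl⟩ := hsub hu
    have hij : j ≠ i := fun hij => hj (hij ▸ hu)
    rw [toReal_dotProduct, neg_dotProduct, simplexVertex_dotProduct_simplexNormal, if_neg hij]
    simp
  rw [toReal_dotProduct, neg_dotProduct, simplexVertex_dotProduct_simplexNormal, if_pos rfl] at hle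
  push_cast at hle
  linarith [n.cast_nonneg (α := ℝ)]

theorem toReal_mem_extremePoints_iff {u : Fin n → ℤ} :
    toReal u ∈ (polarDual (projectivePolytope n).carrier).extremePoints ℝ ↔
      ∃ j, simplexNormal j = u := by
  simp only [extremePoints_polarDual_projectivePolytope, Set.mem_range, toReal_injective.eq_iff]

theorem simplexNormal_injective :
    Function.Injective (simplexNormal : Fin (n + 1) → Fin n → ℤ) := by
  intro i j hij
  by_contra hne
  have h := simplexVertex_dotProduct_simplexNormal i j
  rw [← hij, simplexVertex_dotProduct_simplexNormal, if_pos rfl, if_neg hne] at h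
  omega

theorem exists_eq_simplexPoint_sub {v : Fin n → ℤ} {j : Fin (n + 1)}
    (hj : v ⬝ᵥ simplexNormal j = -1) (hv : ∀ k, k ≠ j → 0 ≤ v ⬝ᵥ simplexNormal k) :
    ∃ i, i ≠ j ∧ v = simplexPoint i - simplexPoint j := by
  have hsum : ∑ k ∈ Finset.univ.erase j, v ⬝ᵥ simplexNormal k = 1 := by
    have hsplit := Finset.add_sum_erase _ (fun k => v ⬝ᵥ simplexNormal k) (Finset.mem_univ j)
    rw [sum_dotProduct_simplexNormal, hj] at hsplit
    omega
  have hnonneg : ∀ k ∈ Finset.univ.erase j, 0 ≤ v ⬝ᵥ simplexNormal k := fun k hk =>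
    hv k (Finset.ne_of_mem_erase hk)
  obtain ⟨i, hi, hpos⟩ : ∃ i ∈ Finset.univ.erase j, 0 < v ⬝ᵥ simplexNormal i :=
    (Finset.sum_pos_iff_of_nonneg hnonneg).1 (hsum ▸ one_pos)
  have hij := Finset.ne_of_mem_erase hi
  refine ⟨i, hij, eq_of_dotProduct_simplexNormal_eq fun k => ?_⟩
  rw [simplexPoint_sub_dotProduct_simplexNormal]
  obtain rfl | hkj := eq_or_ne k j
  · rw [if_neg hij, if_pos rfl, hj, zero_sub]
  have hk : k ∈ Finset.univ.erase j := Finset.mem_erase.2 ⟨hkj, Finset.mem_univ k⟩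
  rw [if_neg hkj.symm, sub_zero]
  split_ifs with hik
  · subst hik
    have hle := Finset.single_le_sum hnonneg hi
    omega
  · have hle := Finset.add_le_sum hnonneg hi hk hik
    have hk0 := hnonneg k hk
    omega

theorem isRoot_iff (u v : Fin n → ℤ) : IsRoot (projectivePolytope n) u v ↔
    ∃ i j : Fin (n + 1), i ≠ j ∧ u = simplexNormal j ∧ v = simplexPoint i - simplexPoint j := by
  simp only [isRoot_iff_dotProduct, toReal_mem_extremePoints_iff]
  constructor
  · rintro ⟨⟨j, rfl⟩, hj, hv⟩
    obtain ⟨i, hij, rfl⟩ := exists_eq_simplexPoint_sub hj fun k hk =>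
      hv _ ⟨k, rfl⟩ (simplexNormal_injective.ne hk)
    exact ⟨i, j, hij, rfl, rfl⟩
  · rintro ⟨i, j, hij, rfl, rfl⟩
    refine ⟨⟨j, rfl⟩, ?_, ?_⟩
    · rw [simplexPoint_sub_dotProduct_simplexNormal, if_neg hij, if_pos rfl, zero_sub]
    · rintro _ ⟨k, rfl⟩ hk
      rw [simplexPoint_sub_dotProduct_simplexNormal, if_neg (fun hjk : j = k => hk (hjk ▸ rfl)),
        sub_zero]
      split_ifs <;> omega

end ProjectiveSpace

section SpecialLinear

variable {n : ℕ}

theorem slAction_single {i j : Fin (n + 1)} (hij : i ≠ j) (q : MvPolynomial (Fin (n + 1)) ℂ) :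
    slAction (LieAlgebra.SpecialLinear.single i j hij 1) q =
      MvPolynomial.X i * MvPolynomial.pderiv j q := by
  unfold slAction
  rw [Fintype.sum_eq_single i, Fintype.sum_eq_single j]
  · simp
  · intro m hm
    simp [hm.symm]
  · intro k hk
    simp [hk.symm]

/-- The monomial `∏_i z_i ^ (⟨v, u_i⟩ + 1)`, the section of the anticanonical bundle of `ℙⁿ`
attached to the lattice point `v`. -/
def sectionMonomial (v : Fin n → ℤ) : MvPolynomial (Fin (n + 1)) ℂ :=
  ∏ i, MvPolynomial.X i ^ (v ⬝ᵥ simplexNormal i + 1).toNat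

theorem anticanonicalSection_eq_linearCombination (a : (projectivePolytope n).Pt → ℂ) :
    anticanonicalSection a =
      Fintype.linearCombination ℂ (fun v : (projectivePolytope n).Pt => sectionMonomial v.1) a := by
  simp only [anticanonicalSection, sectionMonomial, MvPolynomial.smul_eq_C_mul,
    Fintype.linearCombination_apply]

theorem neg_one_le_dotProduct_simplexNormal (v : (projectivePolytope n).Pt) (i : Fin (n + 1)) :
    -1 ≤ v.1 ⬝ᵥ simplexNormal i :=
  toReal_mem_carrier_iff.1 v.2 _ (toReal_mem_extremePoints_iff.2 ⟨i, rfl⟩)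

theorem sectionMonomial_eq_monomial (v : Fin n → ℤ) : sectionMonomial v = MvPolynomial.monomial
    (Finsupp.equivFunOnFinite.symm fun k => (v ⬝ᵥ simplexNormal k + 1).toNat) 1 := by
  rw [MvPolynomial.monomial_eq, MvPolynomial.C_1, one_mul, Finsupp.prod_fintype _ _ (by simp)]
  rfl

theorem X_mul_pderiv_sectionMonomial {i j : Fin (n + 1)} (hij : i ≠ j)
    (v : (projectivePolytope n).Pt) :
    MvPolynomial.X i * MvPolynomial.pderiv j (sectionMonomial v.1) =
      ((v.1 ⬝ᵥ simplexNormal j + 1 : ℤ) : ℂ) •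
        sectionMonomial (v.1 + (simplexPoint i - simplexPoint j)) := by
  have hexponent (k : Fin (n + 1)) := neg_one_le_dotProduct_simplexNormal v k
  have hcast : (((v.1 ⬝ᵥ simplexNormal j + 1).toNat : ℕ) : ℂ) =
      ((v.1 ⬝ᵥ simplexNormal j + 1 : ℤ) : ℂ) := by
    rw [← Int.cast_natCast, Int.toNat_of_nonneg (by linarith [hexponent j])]
  rw [sectionMonomial_eq_monomial, sectionMonomial_eq_monomial, MvPolynomial.pderiv_monomial,
    MvPolynomial.X, MvPolynomial.monomial_mul, MvPolynomial.smul_monomial,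
    Finsupp.equivFunOnFinite_symm_apply_apply, one_mul, one_mul, smul_eq_mul, mul_one, hcast]
  by_cases hvj : v.1 ⬝ᵥ simplexNormal j = -1
  · simp [hvj]
  congr 2
  ext k
  have hk := hexponent k
  simp only [Finsupp.add_apply, Finsupp.tsub_apply, Finsupp.single_apply,
    Finsupp.equivFunOnFinite_symm_apply_apply, add_dotProduct,
    simplexPoint_sub_dotProduct_simplexNormal]
  obtain rfl | hjk := eq_or_ne j k
  · rw [if_neg hij, if_pos rfl]
    omega
  · rw [if_neg hjk]
    split_ifs <;> omega

theorem exists_rootOperator_eq_fderiv {i j : Fin (n + 1)} (hij : i ≠ j)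
    (a : (projectivePolytope n).Pt → ℂ) : ∃ b : (projectivePolytope n).Pt → ℂ,
      anticanonicalSection b =
        slAction (LieAlgebra.SpecialLinear.single i j hij 1) (anticanonicalSection a) ∧
      ∀ f : ((projectivePolytope n).Pt → ℂ) → ℂ,
        rootOperator (projectivePolytope n) (simplexNormal j)
            (simplexPoint i - simplexPoint j) f a = fderiv ℂ f a b := by
  have hroot := (isRoot_iff (n := n) _ _).2 ⟨i, j, hij, rfl, rfl⟩
  obtain ⟨w, hw⟩ := hroot.exists_add_eq
  refine ⟨∑ v, (((v.1 ⬝ᵥ simplexNormal j + 1 : ℤ) : ℂ) * a v) • Pi.single (w v) 1, ?_,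
    fun f => ?_⟩
  · simp only [slAction_single, anticanonicalSection_eq_linearCombination, map_sum, map_smul,
      Fintype.linearCombination_apply_single, one_smul]
    rw [Fintype.linearCombination_apply, map_sum, Finset.mul_sum]
    refine Finset.sum_congr rfl fun v _ => ?_
    rw [Derivation.map_smul, mul_smul_comm, X_mul_pderiv_sectionMonomial hij, smul_smul, mul_comm]
    by_cases hv : v.1 ⬝ᵥ simplexNormal j = -1
    · simp [hv]
    · rw [hw v hv]
  · simp only [rootOperator_eq_sum hw, map_sum, map_smul, smul_eq_mul, partialDeriv]

end SpecialLinear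

section Assembly

variable {n : ℕ} {P : ReflexivePolytope n} {T : Geometry.SimplicialComplex ℝ (Fin n → ℝ)}
  {R : Type*} [NormedCommRing R] [NormedAlgebra ℂ R] [Module.Finite ℂ R] [CompleteSpace R]
  {r : ℕ} {l : Module.Basis (Fin r) ℤ (relationLattice P)} {Q : ℝ}

theorem isExtendedGKZSolution_bFunction (hT : IsRegularProjective P T)
    (φ : Cohomology P T ≃ₐ[ℂ] R) (hQ : 1 ≤ Q)
    (hdom : ∀ γ : P.Pt → ℤ, IsDominated l Q fun ℓ => gammaCoeff (φ ∘ divisorClass P T) (γ + ℓ.1))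
    (hO : IsDominated l Q fun ℓ => φ (oCoeff P T ℓ.1)) {U : Set (P.Pt → ℂ)} (hU : IsOpen U)
    (hUl : U ⊆ lcslNhd P l (convRadius l Q)) {lg : (P.Pt → ℂ) → P.Pt → ℂ} (hlg : IsLogBranch U lg)
    (α : Cohomology P T →ₗ[ℂ] ℂ) :
    IsExtendedGKZSolution P U fun a =>
      α (bFunction P T lg a * -divisorClass P T P.origin) := by
  let ψ : R →L[ℂ] ℂ := -LinearMap.toContinuousLinearMap (α ∘ₗ φ.symm.toLinearMap)
  have hseries : Set.EqOn (fun a => α (bFunction P T lg a * -divisorClass P T P.origin))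
      (fun a => ψ (hyperSeries (φ ∘ divisorClass P T) lg (-Pi.single P.origin 1) a)) U := by
    intro a ha
    simp [ψ, ← map_bFunction_mul_divisorClass_origin hQ hT φ hO (hUl ha)]
  have hunit (v : P.Pt) (k : ℕ) :
      IsUnit ((φ ∘ divisorClass P T) v + ((k + 1 : ℕ) : R)) := by
    simpa using (isUnit_divisorClass_add_natCast_succ hT v k).map φ
  have hsum : ∑ v, (φ ∘ divisorClass P T) v = 0 := by
    simpa using congrArg φ (sum_divisorClass (P := P) (T := T))
  have hlin (j : Fin n) : ∑ v : P.Pt, (v.1 j : ℂ) • (φ ∘ divisorClass P T) v = 0 := by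
    simpa using congrArg φ (sum_smul_divisorClass (P := P) (T := T) j)
  refine ⟨isGKZSolution_of_eqOn ψ hunit hQ hdom hU hUl hlg hsum hlin hseries,
    fun u v huv a ha => ?_⟩
  obtain ⟨w, hw⟩ := huv.exists_add_eq
  exact rootOperator_eq_zero_of_eqOn ψ hunit hQ hdom hU hUl hlg hsum hlin hseries
    (v := ⟨v, huv.mem_carrier⟩) huv.dotProduct_eq hw ha

end Assembly

end GKZ

end

theorem mainTheorem3_general {n : ℕ} (P : GKZ.ReflexivePolytope n)
    (T : Geometry.SimplicialComplex ℝ (Fin n → ℝ)) (hT : GKZ.IsRegularProjective P T) (r : ℕ)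
    (l : Module.Basis (Fin r) ℤ (GKZ.relationLattice P))
    (hl : ∀ ℓ : GKZ.relationLattice P, ℓ.1 ∈ GKZ.moriPoints P T → ∀ j, 0 ≤ l.repr ℓ j) :
    ∃ ε : ℝ, 0 < ε ∧
      (∀ a ∈ GKZ.lcslNhd P l ε,
        Summable fun ℓ : GKZ.moriPoints P T => GKZ.laurent ℓ.1 a • GKZ.oCoeff P T ℓ.1) ∧
      ∀ U : Set (P.Pt → ℂ), IsOpen U → U ⊆ GKZ.lcslNhd P l ε →
        ∀ lg : (P.Pt → ℂ) → P.Pt → ℂ, GKZ.IsLogBranch U lg →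
          ∀ α : GKZ.Cohomology P T →ₗ[ℂ] ℂ,
            GKZ.IsExtendedGKZSolution P U fun a =>
              α (GKZ.bFunction P T lg a * -GKZ.divisorClass P T P.origin) := by
  have := GKZ.finite_cohomology hT
  obtain ⟨R, _, _, ⟨φ⟩⟩ := GKZ.exists_normedAlgebra (GKZ.Cohomology P T)
  have : Module.Finite ℂ R := Module.Finite.equiv φ.toLinearEquiv
  have : CompleteSpace R := FiniteDimensional.complete ℂ R
  obtain ⟨Q, hQ, hdom, hO⟩ := GKZ.exists_isDominated hT hl φ
  exact ⟨GKZ.convRadius l Q, GKZ.convRadius_pos l hQ,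
    fun a ha => (GKZ.hasSum_smul_oCoeff hQ hT φ hO ha).summable,
    fun U hU hUl lg hlg α => GKZ.isExtendedGKZSolution_bFunction hT φ hQ hdom hO hU hUl hlg α⟩

theorem mainTheorem3 (n : ℕ) :
    (∀ T : Geometry.SimplicialComplex ℝ (Fin n → ℝ),
      GKZ.IsRegularProjective (GKZ.projectivePolytope n) T →
      ∀ (r : ℕ)
        (l : Module.Basis (Fin r) ℤ (GKZ.relationLattice (GKZ.projectivePolytope n))),
        (∀ ℓ : GKZ.relationLattice (GKZ.projectivePolytope n),
          ℓ.1 ∈ GKZ.moriPoints (GKZ.projectivePolytope n) T → ∀ j, 0 ≤ l.repr ℓ j) →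
        ∃ ε : ℝ, 0 < ε ∧
          (∀ a ∈ GKZ.lcslNhd (GKZ.projectivePolytope n) l ε,
            Summable fun ℓ : GKZ.moriPoints (GKZ.projectivePolytope n) T =>
              GKZ.laurent ℓ.1 a • GKZ.oCoeff (GKZ.projectivePolytope n) T ℓ.1) ∧
          ∀ U : Set ((GKZ.projectivePolytope n).Pt → ℂ),
            IsOpen U → U ⊆ GKZ.lcslNhd (GKZ.projectivePolytope n) l ε →
            ∀ lg : ((GKZ.projectivePolytope n).Pt → ℂ) → (GKZ.projectivePolytope n).Pt → ℂ,
              GKZ.IsLogBranch U lg →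
              ∀ α : GKZ.Cohomology (GKZ.projectivePolytope n) T →ₗ[ℂ] ℂ,
                GKZ.IsExtendedGKZSolution (GKZ.projectivePolytope n) U fun a =>
                  α (GKZ.bFunction (GKZ.projectivePolytope n) T lg a *
                    -GKZ.divisorClass (GKZ.projectivePolytope n) T
                      (GKZ.projectivePolytope n).origin)) ∧
    (∀ u v : Fin n → ℤ, GKZ.IsRoot (GKZ.projectivePolytope n) u v ↔
      ∃ i j : Fin (n + 1), i ≠ j ∧ u = GKZ.simplexNormal j ∧
        v = GKZ.simplexPoint i - GKZ.simplexPoint j) ∧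
    (∀ (i j : Fin (n + 1)) (hij : i ≠ j) (a : (GKZ.projectivePolytope n).Pt → ℂ),
      ∃ b : (GKZ.projectivePolytope n).Pt → ℂ,
        GKZ.anticanonicalSection b =
          GKZ.slAction (LieAlgebra.SpecialLinear.single i j hij 1)
            (GKZ.anticanonicalSection a) ∧
        ∀ f : ((GKZ.projectivePolytope n).Pt → ℂ) → ℂ,
          GKZ.rootOperator (GKZ.projectivePolytope n) (GKZ.simplexNormal j)
            (GKZ.simplexPoint i - GKZ.simplexPoint j) f a = fderiv ℂ f a b) :=
  ⟨mainTheorem3_general (GKZ.projectivePolytope n), GKZ.isRoot_iff,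
    fun _ _ => GKZ.exists_rootOperator_eq_fderiv⟩
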